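/- Let $G$ be a (real, finite-dimensional, Hausdorff, second countable) Lie group with neutral element $e$, dimension $d$ and Lie algebra $\mathfrak g$, and let $C_c^\infty(G)$ be the space of real-valued smooth functions with compact support on $G$. Fix a basis $X_1,\dots,X_d$ of $\mathfrak g$, whose elements act on smooth functions as left-invariant vector fields. A canonical co-ordinate neighbourhood of $e$ is an open set $U\ni e$ together with functions $x_1,\dots,x_d\in C_c^\infty(G)$ such that $x_i(e)=0$ for all $i$, the map $g\mapsto(x_1(g),\dots,x_d(g))$ is a homeomorphism of $U$ onto an open subset of $\mathbb R^d$, and $\exp\left(\sum_{i=1}^d x_i(g)X_i\right)=g$ for all $g\in U$. A Borel measure $\mu$ on $G$ is a Lévy measure if $\mu(\{e\})=0$ and, for every canonical co-ordinate neighbourhood $U$ of $e$ with co-ordinate functions $x_1,\dots,x_d$, $\int_U\sum_{i=1}^d x_i(g)^2\,\mu(dg)<\infty$ and $\mu(U^c)<\infty$. A linear functional $T:C_c^\infty(G)\to\mathbb R$ satisfies the positive maximum principle (PMP) if $T\varphi\le 0$ for every $\varphi\in C_c^\infty(G)$ with $\varphi(e)=\sup_{g\in G}\varphi(g)\ge 0$.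 Theorem. Fix a canonical co-ordinate neighbourhood of $e$ with co-ordinate functions $x_1,\dots,x_d\in C_c^\infty(G)$, and let $T:C_c^\infty(G)\to\mathbb R$ be a linear functional satisfying the PMP. Then there exist $c\ge 0$, $b=(b_1,\dots,b_d)\in\mathbb R^d$, a symmetric non-negative definite real $d\times d$ matrix $a=(a_{ij})$ and a Lévy measure $\mu$ on $G$ such that, for all $\varphi\in C_c^\infty(G)$, the integrand below is $\mu$-integrable and $$T\varphi=\sum_{i,j=1}^d a_{ij}X_iX_j\varphi(e)+\sum_{i=1}^d b_iX_i\varphi(e)-c\varphi(e)+\int_G\Big(\varphi(g)-\varphi(e)-\sum_{i=1}^d x_i(g)X_i\varphi(e)\Big)\mu(dg).$$ Moreover $(a,b,c,\mu)$ is uniquely determined by $T$ (for the fixed $X_1,\dots,X_d$ and $x_1,\dots,x_d$). -/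

import Mathlib

open MeasureTheory Set
open scoped Manifold ContDiff

noncomputable section

namespace LieGroupPMP

variable {E : Type*} [NormedAddCommGroup E] [NormedSpace ℝ E]
  {G : Type*} [TopologicalSpace G] [ChartedSpace E G] [Group G]

variable (E G) in
/-- `C_c^∞(G)`: the real vector space of smooth, compactly supported, real-valued functions. -/
def CcSmooth : Submodule ℝ (G → ℝ) where
  carrier := {f | ContMDiff 𝓘(ℝ, E) 𝓘(ℝ, ℝ) ∞ f ∧ HasCompactSupport f}
  add_mem' hf hg := ⟨hf.1.add hg.1, hf.2.add hg.2⟩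
  zero_mem' := ⟨contMDiff_const, HasCompactSupport.zero⟩
  smul_mem' c _ hf := ⟨(contMDiff_const (c := c)).mul hf.1, hf.2.smul_left (f := fun _ => c)⟩

/-- A Lie algebra element `v` acting on functions as a (left-invariant) first order
differential operator. -/
def lieDeriv (v : GroupLieAlgebra 𝓘(ℝ, E) G) (f : G → ℝ) (g : G) : ℝ :=
  mfderiv 𝓘(ℝ, E) 𝓘(ℝ, ℝ) f g (mulInvariantVectorField v g)

open Classical in
/-- The exponential map: `exp v = γ 1`, where `γ` is the integral curve of the left-invariant
vector field of `v` with `γ 0 = e`.  On a Lie group this curve exists and is unique, see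
`exists_integralCurve` and `lieExp_eq`. -/
def lieExp (v : GroupLieAlgebra 𝓘(ℝ, E) G) : G :=
  if h : ∃ γ : ℝ → G, γ 0 = 1 ∧ IsMIntegralCurve (I := 𝓘(ℝ, E)) γ (mulInvariantVectorField v)
  then h.choose 1 else 1

/-- Left-invariant vector fields are `C^1`. -/
theorem contMDiff_invariant [LieGroup 𝓘(ℝ, E) ∞ G] (v : GroupLieAlgebra 𝓘(ℝ, E) G) :
    ContMDiff 𝓘(ℝ, E) (𝓘(ℝ, E)).tangent 1
      (fun g : G => (⟨g, mulInvariantVectorField v g⟩ : TangentBundle 𝓘(ℝ, E) G)) := by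
  have : LieGroup 𝓘(ℝ, E) (minSmoothness ℝ 3) G := LieGroup.of_le (n := ∞) (by
    simp only [minSmoothness_of_isRCLikeNormedField]
    exact ENat.LEInfty.out)
  exact (contMDiff_mulInvariantVectorField v).of_le (by
    simp only [minSmoothness_of_isRCLikeNormedField]
    norm_num)

theorem mfderiv_mul_left_invariant [LieGroup 𝓘(ℝ, E) ∞ G] (v : GroupLieAlgebra 𝓘(ℝ, E) G)
    (g h : G) :
    mfderiv 𝓘(ℝ, E) 𝓘(ℝ, E) (g * ·) h (mulInvariantVectorField v h)
      = mulInvariantVectorField v (g * h) := by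
  have hd : ∀ a b : G, MDifferentiableAt 𝓘(ℝ, E) 𝓘(ℝ, E) (a * ·) b := fun a b =>
    (contMDiff_mul_left (I := 𝓘(ℝ, E)) (n := ∞) (a := a)).mdifferentiable (by simp) b
  have key : mfderiv 𝓘(ℝ, E) 𝓘(ℝ, E) ((g * ·) ∘ (h * ·)) (1 : G)
      = (mfderiv 𝓘(ℝ, E) 𝓘(ℝ, E) (g * ·) (h * 1)).comp
        (mfderiv 𝓘(ℝ, E) 𝓘(ℝ, E) (h * ·) (1 : G)) :=
    mfderiv_comp (1 : G) (hd g (h * 1)) (hd h 1)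
  have hfun : ((g * ·) ∘ (h * ·) : G → G) = ((g * h) * ·) := by
    funext k; simp [mul_assoc]
  rw [hfun] at key
  have := congrArg (fun L => L v) key
  rw [mul_one] at this
  exact this.symm

/-- The one-parameter subgroup with velocity `v` exists. -/
theorem exists_integralCurve [CompleteSpace E] [T2Space G] [LieGroup 𝓘(ℝ, E) ∞ G]
    (v : GroupLieAlgebra 𝓘(ℝ, E) G) :
    ∃ γ : ℝ → G, γ 0 = 1 ∧ IsMIntegralCurve (I := 𝓘(ℝ, E)) γ (mulInvariantVectorField v) := by
  have : LieGroup 𝓘(ℝ, E) 1 G := LieGroup.of_le (n := ∞) (by simp)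
  have : IsManifold 𝓘(ℝ, E) 1 G := inferInstance
  obtain ⟨γ, h0, hγ⟩ := exists_isMIntegralCurveAt_of_contMDiffAt_boundaryless (t₀ := 0)
    ((contMDiff_invariant v).contMDiffAt (x := (1 : G)))
  rw [isMIntegralCurveAt_iff'] at hγ
  obtain ⟨ε, hε, hγ⟩ := hγ
  refine exists_isMIntegralCurve_of_isMIntegralCurveOn (contMDiff_invariant v) hε
    (fun g => ⟨fun t => g * γ t, by simp [h0], ?_⟩) 1
  intro t ht
  have ht' : t ∈ Metric.ball (0 : ℝ) ε := by rw [Real.ball_eq_Ioo]; simpa using ht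
  have h1 := hγ t ht'
  rw [Real.ball_eq_Ioo, zero_sub, zero_add] at h1
  have h2 : HasMFDerivAt 𝓘(ℝ, E) 𝓘(ℝ, E) (g * ·) (γ t)
      (mfderiv 𝓘(ℝ, E) 𝓘(ℝ, E) (g * ·) (γ t)) :=
    ((contMDiff_mul_left (I := 𝓘(ℝ, E)) (n := ∞) (a := g)).mdifferentiable
      (by simp) (γ t)).hasMFDerivAt
  have h3 := h2.comp_hasMFDerivWithinAt t h1
  have e : (1 : ℝ →L[ℝ] ℝ).smulRight (mulInvariantVectorField v (g * γ t))
      = (mfderiv 𝓘(ℝ, E) 𝓘(ℝ, E) (g * ·) (γ t)).comp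
        ((1 : ℝ →L[ℝ] ℝ).smulRight (mulInvariantVectorField v (γ t))) := ?_
  · exact e ▸ h3
  apply ContinuousLinearMap.ext_ring
  change (1 : ℝ) • mulInvariantVectorField v (g * γ t)
    = mfderiv 𝓘(ℝ, E) 𝓘(ℝ, E) (g * ·) (γ t) ((1 : ℝ) • mulInvariantVectorField v (γ t))
  rw [one_smul, one_smul, mfderiv_mul_left_invariant]

/-- The exponential map is given by any one-parameter subgroup with velocity `v`. -/
theorem lieExp_eq [CompleteSpace E] [T2Space G] [LieGroup 𝓘(ℝ, E) ∞ G]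
    (v : GroupLieAlgebra 𝓘(ℝ, E) G) (γ : ℝ → G) (h0 : γ 0 = 1)
    (hγ : IsMIntegralCurve (I := 𝓘(ℝ, E)) γ (mulInvariantVectorField v)) :
    lieExp v = γ 1 := by
  have : LieGroup 𝓘(ℝ, E) 1 G := LieGroup.of_le (n := ∞) (by simp)
  have : IsManifold 𝓘(ℝ, E) 1 G := inferInstance
  have h : ∃ γ : ℝ → G, γ 0 = 1 ∧
      IsMIntegralCurve (I := 𝓘(ℝ, E)) γ (mulInvariantVectorField v) := ⟨γ, h0, hγ⟩
  have e : h.choose = γ := isMIntegralCurve_Ioo_eq_of_contMDiff_boundaryless (t₀ := 0)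
    (contMDiff_invariant v) h.choose_spec.2 hγ (h.choose_spec.1.trans h0.symm)
  rw [lieExp, dif_pos h, e]

/-- `U` is an open canonical co-ordinate neighbourhood of `e` relative to the basis `X` of the
Lie algebra, with co-ordinate functions `x i` that have been extended to elements of
`C_c^∞(G)`: `g ↦ (x 1 g, …, x d g)` is a homeomorphism of `U` onto an open subset of `ℝ^d`, which
maps `e` to `0`, and `exp (∑ i, x i g • X i) = g` on `U`. -/
structure IsCanonicalCoord {d : ℕ} (X : Module.Basis (Fin d) ℝ (GroupLieAlgebra 𝓘(ℝ, E) G))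
    (U : Set G) (x : Fin d → G → ℝ) : Prop where
  isOpen : IsOpen U
  one_mem : (1 : G) ∈ U
  smooth : ∀ i, x i ∈ CcSmooth E G
  map_one : ∀ i, x i 1 = 0
  isOpenEmbedding : Topology.IsOpenEmbedding (fun (g : U) (i : Fin d) => x i g)
  exp_eq : ∀ g ∈ U, lieExp (∑ i, x i g • X i) = g

/-- Lévy measures on `G`. -/
structure IsLevyMeasure {d : ℕ} (X : Module.Basis (Fin d) ℝ (GroupLieAlgebra 𝓘(ℝ, E) G))
    [MeasurableSpace G] (μ : Measure G) : Prop where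
  singleton_one : μ {1} = 0
  lintegral_lt_top : ∀ (U : Set G) (x : Fin d → G → ℝ), IsCanonicalCoord X U x →
    ∫⁻ g in U, ENNReal.ofReal (∑ i, x i g ^ 2) ∂μ < ⊤
  compl_lt_top : ∀ (U : Set G) (x : Fin d → G → ℝ), IsCanonicalCoord X U x → μ Uᶜ < ⊤

/-- The positive maximum principle (at `e`) for a linear functional on `C_c^∞(G)`. -/
def SatisfiesPMP (T : CcSmooth E G →ₗ[ℝ] ℝ) : Prop :=
  ∀ φ : CcSmooth E G, (∀ τ : G, φ.1 τ ≤ φ.1 1) → 0 ≤ φ.1 1 → T φ ≤ 0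

/-- The compensated integrand `φ(g) - φ(e) - ∑ i, x_i(g) X_i φ(e)`. -/
def compensated {d : ℕ} (X : Module.Basis (Fin d) ℝ (GroupLieAlgebra 𝓘(ℝ, E) G))
    (x : Fin d → G → ℝ) (φ : G → ℝ) (g : G) : ℝ :=
  φ g - φ 1 - ∑ i, x i g * lieDeriv (X i) φ 1

/-- `(a, b, c, μ)` are characteristics of the functional `T`: `c ≥ 0`, `a` is symmetric and
non-negative definite (`Matrix.PosSemidef` includes symmetry), `μ` is a Lévy measure and `T` is
given by the canonical form. -/
structure HasCharacteristics {d : ℕ} (X : Module.Basis (Fin d) ℝ (GroupLieAlgebra 𝓘(ℝ, E) G))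
    (x : Fin d → G → ℝ) [MeasurableSpace G] (T : CcSmooth E G →ₗ[ℝ] ℝ)
    (a : Matrix (Fin d) (Fin d) ℝ) (b : Fin d → ℝ) (c : ℝ) (μ : Measure G) : Prop where
  nonneg : 0 ≤ c
  posSemidef : a.PosSemidef
  levy : IsLevyMeasure X μ
  form : ∀ φ : CcSmooth E G,
    T φ = ∑ i, ∑ j, a i j * lieDeriv (X i) (lieDeriv (X j) φ.1) 1
      + ∑ i, b i * lieDeriv (X i) φ.1 1 - c * φ.1 1
      + ∫ g, compensated X x φ.1 g ∂μ

end LieGroupPMP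

end

/-! Applied to `-φ`, the PMP makes `T` nonnegative on nonnegative functions vanishing at `e`.
Weighting by a smooth `ρ ≥ 0` that vanishes only at `e` makes `φ ↦ T (φ * ρ)` a positive functional.
The Riesz extension and representation theorems give it a measure, and dividing that measure by `ρ`
off `e` gives `μ`, which represents `T` on functions vanishing near `e` (`exists_isJumpMeasure`).
The PMP bounds `T` on cut-offs of `∑ x_i²` and of `1 - ψ`, with `ψ` a bump at `e`. By Fatou both are
`μ`-integrable, so `μ` is a Lévy measure.

Let `S` be `T` minus the compensated integral. It vanishes on functions vanishing near `e` and is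
still nonnegative on nonnegative functions vanishing at `e`. Taylor expansion along one-parameter
subgroups writes `φ` near `e` as a quadratic polynomial in the `x_i` plus a remainder `o(∑ x_i²)`.
Positivity forces `S` to kill the remainder (`IsCanonicalCoord.local_eq`), so `S` has the local
form, with coefficients its values on `x_i * x_j`, `x_i` and `ψ`.

For uniqueness, the local terms vanish on functions vanishing near `e`, so `T` determines `μ`. The
functions `ψ`, `x_k * x_l` and `x_k` then determine `c`, `a` and `b`. -/

namespace LieGroupPMP

open Filter Topology
open scoped CompactlySupported

/-! ### Calculus of left-invariant derivatives. -/

section Calculus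

variable {E : Type*} [NormedAddCommGroup E] [NormedSpace ℝ E]
  {G : Type*} [TopologicalSpace G] [ChartedSpace E G] [Group G]

/-- Left-invariant vector fields are smooth. -/
theorem contMDiff_mulInvariantVectorField_infty [LieGroup 𝓘(ℝ, E) ∞ G]
    (v : GroupLieAlgebra 𝓘(ℝ, E) G) :
    ContMDiff 𝓘(ℝ, E) (𝓘(ℝ, E)).tangent ∞
      (fun g : G => (⟨g, mulInvariantVectorField v g⟩ : TangentBundle 𝓘(ℝ, E) G)) := by
  -- The field at `g` is the differential of multiplication at `(g, e)` applied to `(0, v)`, so it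
  -- is a composite of smooth maps.
  let fg : G → TangentBundle 𝓘(ℝ, E) G := fun g ↦ Bundle.TotalSpace.mk' E g 0
  have sfg : ContMDiff 𝓘(ℝ, E) (𝓘(ℝ, E)).tangent ∞ fg := Bundle.contMDiff_zeroSection _ _
  let fv : G → TangentBundle 𝓘(ℝ, E) G := fun _ ↦ Bundle.TotalSpace.mk' E 1 v
  have sfv : ContMDiff 𝓘(ℝ, E) (𝓘(ℝ, E)).tangent ∞ fv := contMDiff_const
  let F₁ : G → (TangentBundle 𝓘(ℝ, E) G × TangentBundle 𝓘(ℝ, E) G) := fun g ↦ (fg g, fv g)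
  have S₁ : ContMDiff 𝓘(ℝ, E) ((𝓘(ℝ, E)).tangent.prod (𝓘(ℝ, E)).tangent) ∞ F₁ :=
    sfg.prodMk sfv
  let F₂ : (TangentBundle 𝓘(ℝ, E) G × TangentBundle 𝓘(ℝ, E) G) →
      TangentBundle (𝓘(ℝ, E).prod 𝓘(ℝ, E)) (G × G) :=
    (equivTangentBundleProd 𝓘(ℝ, E) G 𝓘(ℝ, E) G).symm
  have S₂ : ContMDiff ((𝓘(ℝ, E)).tangent.prod (𝓘(ℝ, E)).tangent)
      (𝓘(ℝ, E).prod 𝓘(ℝ, E)).tangent ∞ F₂ := contMDiff_equivTangentBundleProd_symm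
  let F₃ : TangentBundle (𝓘(ℝ, E).prod 𝓘(ℝ, E)) (G × G) → TangentBundle 𝓘(ℝ, E) G :=
    tangentMap (𝓘(ℝ, E).prod 𝓘(ℝ, E)) 𝓘(ℝ, E) (fun (p : G × G) ↦ p.1 * p.2)
  have S₃ : ContMDiff (𝓘(ℝ, E).prod 𝓘(ℝ, E)).tangent (𝓘(ℝ, E)).tangent ∞ F₃ :=
    ContMDiff.contMDiff_tangentMap (contMDiff_mul 𝓘(ℝ, E) ∞) (m := ∞) (by simp)
  convert! (S₃.comp S₂).comp S₁ with g
  · simp [F₁, F₂, F₃, fg, fv]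
  · simp only [Function.comp_apply, tangentMap, F₃, F₂, F₁, fg, fv]
    rw [mfderiv_prod_eq_add_apply ((contMDiff_mul 𝓘(ℝ, E) ∞).mdifferentiableAt (by simp))]
    change (mfderiv 𝓘(ℝ, E) 𝓘(ℝ, E) (g * ·) (1 : G)) v
      = (mfderiv 𝓘(ℝ, E) 𝓘(ℝ, E) (· * (1 : G)) g) 0
        + (mfderiv 𝓘(ℝ, E) 𝓘(ℝ, E) (g * ·) (1 : G)) v
    erw [map_zero, zero_add]

theorem contMDiff_lieDeriv [LieGroup 𝓘(ℝ, E) ∞ G]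
    (v : GroupLieAlgebra 𝓘(ℝ, E) G) {f : G → ℝ}
    (hf : ContMDiff 𝓘(ℝ, E) 𝓘(ℝ, ℝ) ∞ f) :
    ContMDiff 𝓘(ℝ, E) 𝓘(ℝ, ℝ) ∞ (lieDeriv v f) := by
  have h1 : ContMDiff (𝓘(ℝ, E)).tangent (𝓘(ℝ, ℝ)).tangent ∞ (tangentMap 𝓘(ℝ, E) 𝓘(ℝ, ℝ) f) :=
    hf.contMDiff_tangentMap (m := ∞) (by simp)
  exact (contMDiff_snd_tangentBundle_modelSpace ℝ 𝓘(ℝ, ℝ)).comp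
    (h1.comp (contMDiff_mulInvariantVectorField_infty v))

theorem lieDeriv_congr (v : GroupLieAlgebra 𝓘(ℝ, E) G) {f f' : G → ℝ} {g : G}
    (h : f =ᶠ[𝓝 g] f') : lieDeriv v f g = lieDeriv v f' g := by
  simp only [lieDeriv, h.mfderiv_eq]
  rfl

theorem lieDeriv_congr_nhds (v : GroupLieAlgebra 𝓘(ℝ, E) G) {f f' : G → ℝ} {g : G}
    (h : f =ᶠ[𝓝 g] f') : lieDeriv v f =ᶠ[𝓝 g] lieDeriv v f' :=
  h.eventuallyEq_nhds.mono fun _ => lieDeriv_congr v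

theorem lieDeriv_const (v : GroupLieAlgebra 𝓘(ℝ, E) G) (c : ℝ) (g : G) :
    lieDeriv v (fun _ => c) g = 0 := by
  simp only [lieDeriv, mfderiv_const]
  rfl

theorem hasCompactSupport_lieDeriv (v : GroupLieAlgebra 𝓘(ℝ, E) G) {f : G → ℝ}
    (hf : HasCompactSupport f) : HasCompactSupport (lieDeriv v f) := by
  refine hf.mono' fun g hg => ?_
  by_contra hgt
  apply hg
  have : f =ᶠ[𝓝 g] fun _ => 0 := notMem_tsupport_iff_eventuallyEq.1 hgt
  rw [lieDeriv_congr v this, lieDeriv_const]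

theorem lieDeriv_mem [LieGroup 𝓘(ℝ, E) ∞ G]
    (v : GroupLieAlgebra 𝓘(ℝ, E) G) {f : G → ℝ} (hf : f ∈ CcSmooth E G) :
    lieDeriv v f ∈ CcSmooth E G :=
  ⟨contMDiff_lieDeriv v hf.1, hasCompactSupport_lieDeriv v hf.2⟩

theorem lieDeriv_sum_smul {ι : Type*} (s : Finset ι) (c : ι → ℝ)
    (X : ι → GroupLieAlgebra 𝓘(ℝ, E) G) (f : G → ℝ) (g : G) :
    lieDeriv (∑ i ∈ s, c i • X i) f g = ∑ i ∈ s, c i * lieDeriv (X i) f g := by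
  have h : ∀ w : GroupLieAlgebra 𝓘(ℝ, E) G, lieDeriv w f g =
    ((mfderiv 𝓘(ℝ, E) 𝓘(ℝ, ℝ) f g).comp (mfderiv 𝓘(ℝ, E) 𝓘(ℝ, E) (g * ·) (1 : G)) :
      E →L[ℝ] ℝ) w := fun w => by
    rfl
  simp only [h]
  erw [map_sum]
  refine Finset.sum_congr rfl fun i _ => ?_
  erw [map_smul]
  rfl

theorem lieDeriv_add (v : GroupLieAlgebra 𝓘(ℝ, E) G) {f f' : G → ℝ}
    (hf : ContMDiff 𝓘(ℝ, E) 𝓘(ℝ, ℝ) ∞ f) (hf' : ContMDiff 𝓘(ℝ, E) 𝓘(ℝ, ℝ) ∞ f') (g : G) :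
    lieDeriv v (f + f') g = lieDeriv v f g + lieDeriv v f' g := by
  simp only [lieDeriv]
  erw [mfderiv_add (hf.mdifferentiableAt (by simp)) (hf'.mdifferentiableAt (by simp))]
  rfl

theorem lieDeriv_mul (v : GroupLieAlgebra 𝓘(ℝ, E) G) {f f' : G → ℝ}
    (hf : ContMDiff 𝓘(ℝ, E) 𝓘(ℝ, ℝ) ∞ f) (hf' : ContMDiff 𝓘(ℝ, E) 𝓘(ℝ, ℝ) ∞ f') (g : G) :
    lieDeriv v (f * f') g = f g * lieDeriv v f' g + f' g * lieDeriv v f g := by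
  simp only [lieDeriv]
  erw [((hf.mdifferentiableAt (by simp)).hasMFDerivAt.mul
    (hf'.mdifferentiableAt (by simp)).hasMFDerivAt).mfderiv]
  rfl

theorem lieDeriv_smul (v : GroupLieAlgebra 𝓘(ℝ, E) G) (c : ℝ) {f : G → ℝ}
    (hf : ContMDiff 𝓘(ℝ, E) 𝓘(ℝ, ℝ) ∞ f) (g : G) :
    lieDeriv v (c • f) g = c * lieDeriv v f g := by
  have := lieDeriv_mul v (contMDiff_const (c := c)) hf g
  rw [lieDeriv_const, mul_zero, add_zero] at this
  exact this

theorem hasDerivAt_comp_integralCurve {v : GroupLieAlgebra 𝓘(ℝ, E) G} {γ : ℝ → G}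
    (hγ : IsMIntegralCurve (I := 𝓘(ℝ, E)) γ (mulInvariantVectorField v)) {f : G → ℝ}
    (hf : ContMDiff 𝓘(ℝ, E) 𝓘(ℝ, ℝ) ∞ f) (t : ℝ) :
    HasDerivAt (fun s => f (γ s)) (lieDeriv v f (γ t)) t := by
  have h := (hf.mdifferentiableAt (x := γ t) (by simp)).hasMFDerivAt.comp t (hγ t)
  obtain ⟨L, hL, hL1⟩ : ∃ L : ℝ →L[ℝ] ℝ, HasFDerivAt (fun s => f (γ s)) L t ∧
      L 1 = lieDeriv v f (γ t) := by
    refine ⟨_, hasMFDerivAt_iff_hasFDerivAt.1 h, ?_⟩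
    change mfderiv 𝓘(ℝ, E) 𝓘(ℝ, ℝ) f (γ t) ((1 : ℝ) • mulInvariantVectorField v (γ t)) = _
    rw [one_smul]
    rfl
  exact hL1 ▸ hL.hasDerivAt

/-- Along the integral curve of `v` through `e`, this is Fermat's theorem in one variable. -/
theorem lieDeriv_one_eq_zero_of_isLocalExtr [LieGroup 𝓘(ℝ, E) ∞ G]
    [CompleteSpace E] [T2Space G]
    (v : GroupLieAlgebra 𝓘(ℝ, E) G)
    {f : G → ℝ} (hf : ContMDiff 𝓘(ℝ, E) 𝓘(ℝ, ℝ) ∞ f) (h : IsLocalExtr f 1) :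
    lieDeriv v f 1 = 0 := by
  obtain ⟨γ, h0, hγ⟩ := exists_integralCurve v
  have hd := hasDerivAt_comp_integralCurve hγ hf 0
  rw [h0] at hd
  have hc : ContinuousAt γ 0 := (hγ 0).continuousAt
  have ht : Tendsto γ (𝓝 0) (𝓝 1) := by simpa [ContinuousAt, h0] using hc
  refine IsLocalExtr.hasDerivAt_eq_zero (f := fun s => f (γ s)) (a := 0) ?_ hd
  rcases h with h | h
  · left
    have := ht.eventually h
    simpa [IsMinFilter, IsLocalMin, h0] using this
  · right
    have := ht.eventually h
    simpa [IsMaxFilter, IsLocalMax, h0] using this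

end Calculus

/-! ### One-variable Taylor bounds on the unit interval. -/

theorem abs_le_of_abs_deriv_le {h h' : ℝ → ℝ} {M : ℝ} (hh : ∀ t, HasDerivAt h (h' t) t)
    (h0 : h 0 = 0) (hM : ∀ t ∈ Icc (0 : ℝ) 1, |h' t| ≤ M) : ∀ t ∈ Icc (0 : ℝ) 1, |h t| ≤ M := by
  intro t ht
  have hM0 : 0 ≤ M := (abs_nonneg _).trans (hM 0 (by simp))
  have := (convex_Icc (0 : ℝ) 1).norm_image_sub_le_of_norm_hasDerivWithin_le
    (f := h) (f' := h') (C := M) (x := 0) (y := t) (fun y _ => (hh y).hasDerivWithinAt) hM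
    (by simp) ht
  rw [h0, sub_zero, sub_zero, Real.norm_eq_abs, Real.norm_eq_abs, abs_of_nonneg ht.1] at this
  exact this.trans (mul_le_of_le_one_right hM0 ht.2)

/-- The derivative of each remainder is the remainder of one order less for the derivative, so the
mean value inequality is iterated. The constant is not sharp; only the order of the remainder
matters later. -/
theorem abs_taylor_two_le {h h₁ h₂ : ℝ → ℝ} {M : ℝ} (hh : ∀ t, HasDerivAt h (h₁ t) t)
    (hh₁ : ∀ t, HasDerivAt h₁ (h₂ t) t) (hM : ∀ t, |h₂ t| ≤ M) :
    |h 1 - h 0 - h₁ 0| ≤ M := by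
  have A := abs_le_of_abs_deriv_le (h := fun t => h₁ t - h₁ 0)
    (fun t => (hh₁ t).sub_const (h₁ 0)) (by simp) (fun t _ => hM t)
  have B := abs_le_of_abs_deriv_le (h := fun t => h t - h 0 - t * h₁ 0)
    (h' := fun t => h₁ t - h₁ 0) (fun t => by
      simpa using ((hh t).sub_const (h 0)).fun_sub ((hasDerivAt_id t).mul_const (h₁ 0)))
    (by simp) A
  simpa using B 1 (by simp)

theorem abs_taylor_three_le {h h₁ h₂ h₃ : ℝ → ℝ} {M : ℝ} (hh : ∀ t, HasDerivAt h (h₁ t) t)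
    (hh₁ : ∀ t, HasDerivAt h₁ (h₂ t) t) (hh₂ : ∀ t, HasDerivAt h₂ (h₃ t) t)
    (hM : ∀ t, |h₃ t| ≤ M) : |h 1 - h 0 - h₁ 0 - 1 / 2 * h₂ 0| ≤ M := by
  have A := abs_le_of_abs_deriv_le (h := fun t => h₂ t - h₂ 0)
    (fun t => (hh₂ t).sub_const (h₂ 0)) (by simp) (fun t _ => hM t)
  have B := abs_le_of_abs_deriv_le (h := fun t => h₁ t - h₁ 0 - t * h₂ 0)
    (h' := fun t => h₂ t - h₂ 0) (fun t => by
      simpa using ((hh₁ t).sub_const (h₁ 0)).fun_sub ((hasDerivAt_id t).mul_const (h₂ 0)))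
    (by simp) A
  have D := abs_le_of_abs_deriv_le (h := fun t => h t - h 0 - t * h₁ 0 - t ^ 2 * (1 / 2 * h₂ 0))
    (h' := fun t => h₁ t - h₁ 0 - t * h₂ 0) (fun t => by
      have := (((hh t).sub_const (h 0)).fun_sub ((hasDerivAt_id t).mul_const (h₁ 0))).fun_sub
        ((hasDerivAt_pow 2 t).mul_const (1 / 2 * h₂ 0))
      refine this.congr_deriv ?_
      push_cast
      ring)
    (by simp) B
  simpa using D 1 (by simp)

/-! ### Taylor expansion along one-parameter subgroups. -/

section Calculus

variable {E : Type*} [NormedAddCommGroup E] [NormedSpace ℝ E]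
  {G : Type*} [TopologicalSpace G] [ChartedSpace E G] [Group G]

theorem exists_abs_le_of_mem {f : G → ℝ} (hf : f ∈ CcSmooth E G) : ∃ C, 0 ≤ C ∧ ∀ g, |f g| ≤ C := by
  obtain ⟨C, hC⟩ := hf.2.exists_bound_of_continuous hf.1.continuous
  exact ⟨C, (norm_nonneg _).trans (hC 1), hC⟩

theorem exists_forall_abs_le_of_mem {ι : Type*} [Fintype ι] {f : ι → G → ℝ}
    (hf : ∀ i, f i ∈ CcSmooth E G) : ∃ C, 0 ≤ C ∧ ∀ i g, |f i g| ≤ C := by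
  choose C h0 hC using fun i => exists_abs_le_of_mem (hf i)
  exact ⟨∑ i, C i, Finset.sum_nonneg fun i _ => h0 i, fun i g =>
    (hC i g).trans (Finset.single_le_sum (fun i _ => h0 i) (Finset.mem_univ i))⟩

theorem lieDeriv_sum {ι : Type*} (s : Finset ι) (c : ι → ℝ) (v : GroupLieAlgebra 𝓘(ℝ, E) G)
    {f : ι → G → ℝ} (hf : ∀ i, f i ∈ CcSmooth E G) (g : G) :
    lieDeriv v (∑ i ∈ s, c i • f i) g = ∑ i ∈ s, c i * lieDeriv v (f i) g := by
  classical
  induction s using Finset.induction_on with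
  | empty =>
    rw [Finset.sum_empty, Finset.sum_empty]
    exact lieDeriv_const v 0 g
  | insert i s hi ih =>
    rw [Finset.sum_insert hi, Finset.sum_insert hi, lieDeriv_add, lieDeriv_smul _ _ (hf i).1, ih]
    · exact ((CcSmooth E G).smul_mem _ (hf i)).1
    · exact ((CcSmooth E G).sum_mem fun i _ => (CcSmooth E G).smul_mem _ (hf i)).1

variable {d : ℕ} (X : Fin d → GroupLieAlgebra 𝓘(ℝ, E) G)

theorem lieDeriv_sum_smul' (v : Fin d → ℝ) (f : G → ℝ) :
    lieDeriv (∑ i, v i • X i) f = ∑ i, v i • lieDeriv (X i) f := by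
  funext g
  simp [lieDeriv_sum_smul]

theorem abs_lieDeriv_sum_smul_le (v : Fin d → ℝ) {f : G → ℝ} {C : ℝ}
    {g : G} (hC : ∀ i, |lieDeriv (X i) f g| ≤ C) :
    |lieDeriv (∑ i, v i • X i) f g| ≤ C * ∑ i, |v i| := by
  rw [lieDeriv_sum_smul, Finset.mul_sum]
  refine (Finset.abs_sum_le_sum_abs _ _).trans (Finset.sum_le_sum fun i _ => ?_)
  rw [abs_mul, mul_comm]
  exact mul_le_mul_of_nonneg_right (hC i) (abs_nonneg _)

variable [LieGroup 𝓘(ℝ, E) ∞ G]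

theorem lieDeriv_lieDeriv_sum_smul (v : Fin d → ℝ) {f : G → ℝ} (hf : f ∈ CcSmooth E G) (g : G) :
    lieDeriv (∑ i, v i • X i) (lieDeriv (∑ i, v i • X i) f) g
      = ∑ i, ∑ j, v i * v j * lieDeriv (X i) (lieDeriv (X j) f) g := by
  rw [lieDeriv_sum_smul]
  refine Finset.sum_congr rfl fun i _ => ?_
  rw [lieDeriv_sum_smul', lieDeriv_sum _ _ _ (fun j => lieDeriv_mem (X j) hf), Finset.mul_sum]
  simp only [mul_assoc]

/-- Expanding in the `X i` leaves finitely many functions `X_i X_j f`, all bounded by compact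
support. Uniformity in `g` controls the derivative along an entire integral curve. -/
theorem exists_abs_lieDeriv_two_le {f : G → ℝ} (hf : f ∈ CcSmooth E G) :
    ∃ C, 0 ≤ C ∧ ∀ (v : Fin d → ℝ) g,
      |lieDeriv (∑ i, v i • X i) (lieDeriv (∑ i, v i • X i) f) g| ≤ C * (∑ i, |v i|) ^ 2 := by
  obtain ⟨C, h0, hC⟩ := exists_forall_abs_le_of_mem (fun p : Fin d × Fin d =>
    lieDeriv_mem (X p.1) (lieDeriv_mem (X p.2) hf))
  refine ⟨C, h0, fun v g => ?_⟩
  rw [pow_two, ← mul_assoc]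
  refine abs_lieDeriv_sum_smul_le X v fun i => ?_
  rw [lieDeriv_sum_smul', lieDeriv_sum _ _ _ (fun j => lieDeriv_mem (X j) hf), Finset.mul_sum]
  refine (Finset.abs_sum_le_sum_abs _ _).trans (Finset.sum_le_sum fun j _ => ?_)
  rw [abs_mul, mul_comm]
  exact mul_le_mul_of_nonneg_right (hC (i, j) g) (abs_nonneg _)

theorem exists_abs_lieDeriv_three_le {f : G → ℝ} (hf : f ∈ CcSmooth E G) :
    ∃ C, 0 ≤ C ∧ ∀ (v : Fin d → ℝ) g,
      |lieDeriv (∑ i, v i • X i) (lieDeriv (∑ i, v i • X i) (lieDeriv (∑ i, v i • X i) f)) g|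
        ≤ C * (∑ i, |v i|) ^ 3 := by
  choose C h0 hC using fun j => exists_abs_lieDeriv_two_le X (lieDeriv_mem (X j) hf)
  refine ⟨∑ j, C j, Finset.sum_nonneg fun j _ => h0 j, fun v g => ?_⟩
  -- Expanding only the innermost derivative reduces to the second-order bound for each `X_j f`.
  have e : lieDeriv (∑ i, v i • X i) (lieDeriv (∑ i, v i • X i) (lieDeriv (∑ i, v i • X i) f)) g
      = ∑ j, v j * lieDeriv (∑ i, v i • X i) (lieDeriv (∑ i, v i • X i) (lieDeriv (X j) f)) g := by
    have e1 : lieDeriv (∑ i, v i • X i) (lieDeriv (∑ i, v i • X i) f)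
        = ∑ j, v j • lieDeriv (∑ i, v i • X i) (lieDeriv (X j) f) := by
      funext k
      rw [lieDeriv_sum_smul' X v f, lieDeriv_sum _ _ _ (fun j => lieDeriv_mem (X j) hf)]
      simp
    rw [e1, lieDeriv_sum _ _ _ (fun j => lieDeriv_mem _ (lieDeriv_mem (X j) hf))]
  rw [e]
  have hs : ∀ j, |v j| ≤ ∑ i, |v i| := fun j =>
    Finset.single_le_sum (fun i _ => abs_nonneg (v i)) (Finset.mem_univ j)
  refine (Finset.abs_sum_le_sum_abs _ _).trans ?_
  rw [Finset.sum_mul]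
  refine Finset.sum_le_sum fun j _ => ?_
  rw [abs_mul, pow_succ', mul_left_comm]
  exact mul_le_mul (hs j) (hC j v g) (abs_nonneg _) ((abs_nonneg _).trans (hs j))

variable [CompleteSpace E] [T2Space G]

/-- Along the integral curve `γ` of `v`, the derivatives of `f ∘ γ` are the iterated `lieDeriv` of
`f`, and `γ 1 = exp v`, so the one-variable bound applies. -/
theorem exists_abs_lieExp_taylor_two_le {f : G → ℝ} (hf : f ∈ CcSmooth E G) :
    ∃ C, 0 ≤ C ∧ ∀ v : Fin d → ℝ,
      |f (lieExp (∑ i, v i • X i)) - f 1 - ∑ i, v i * lieDeriv (X i) f 1|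
        ≤ C * (∑ i, |v i|) ^ 2 := by
  obtain ⟨C, h0, hC⟩ := exists_abs_lieDeriv_two_le X hf
  refine ⟨C, h0, fun v => ?_⟩
  obtain ⟨γ, hγ0, hγ⟩ := exists_integralCurve (∑ i, v i • X i)
  have := abs_taylor_two_le (hasDerivAt_comp_integralCurve hγ hf.1)
    (hasDerivAt_comp_integralCurve hγ (lieDeriv_mem _ hf).1) (fun t => hC v (γ t))
  rw [hγ0, lieDeriv_sum_smul] at this
  rwa [lieExp_eq _ γ hγ0 hγ]

theorem exists_abs_lieExp_taylor_three_le {f : G → ℝ} (hf : f ∈ CcSmooth E G) :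
    ∃ C, 0 ≤ C ∧ ∀ v : Fin d → ℝ,
      |f (lieExp (∑ i, v i • X i)) - f 1 - ∑ i, v i * lieDeriv (X i) f 1
          - 1 / 2 * ∑ i, ∑ j, v i * v j * lieDeriv (X i) (lieDeriv (X j) f) 1|
        ≤ C * (∑ i, |v i|) ^ 3 := by
  obtain ⟨C, h0, hC⟩ := exists_abs_lieDeriv_three_le X hf
  refine ⟨C, h0, fun v => ?_⟩
  obtain ⟨γ, hγ0, hγ⟩ := exists_integralCurve (∑ i, v i • X i)
  have := abs_taylor_three_le (hasDerivAt_comp_integralCurve hγ hf.1)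
    (hasDerivAt_comp_integralCurve hγ (lieDeriv_mem _ hf).1)
    (hasDerivAt_comp_integralCurve hγ (lieDeriv_mem _ (lieDeriv_mem _ hf)).1)
    (fun t => hC v (γ t))
  rw [hγ0, lieDeriv_lieDeriv_sum_smul X v hf, lieDeriv_sum_smul] at this
  rwa [lieExp_eq _ γ hγ0 hγ]

end Calculus

/-! ### Taylor expansion in canonical co-ordinates. -/

section Coordinates

variable {E : Type*} [NormedAddCommGroup E] [NormedSpace ℝ E]
  {G : Type*} [TopologicalSpace G] [ChartedSpace E G] [Group G]
  {d : ℕ} {X : Module.Basis (Fin d) ℝ (GroupLieAlgebra 𝓘(ℝ, E) G)}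
  {U : Set G} {x : Fin d → G → ℝ}

/-- Every small vector is the coordinate vector of a point of `U`. -/
theorem IsCanonicalCoord.exists_eq (hU : IsCanonicalCoord X U x) :
    ∀ᶠ w : Fin d → ℝ in 𝓝 0, ∃ g ∈ U, ∀ i, x i g = w i := by
  have h1 : (fun i => x i (⟨1, hU.one_mem⟩ : U)) = (0 : Fin d → ℝ) := by
    funext i
    exact hU.map_one i
  have := hU.isOpenEmbedding.isOpen_range.mem_nhds ⟨⟨1, hU.one_mem⟩, rfl⟩
  simp only [h1] at this
  filter_upwards [this] with w hw
  obtain ⟨g, rfl⟩ := hw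
  exact ⟨g, g.2, fun i => rfl⟩

theorem sq_sum_abs_le (v : Fin d → ℝ) : (∑ i, |v i|) ^ 2 ≤ d * ∑ i, v i ^ 2 := by
  simpa using sq_sum_le_card_mul_sum_sq (s := Finset.univ) (f := fun i => |v i|)

variable [LieGroup 𝓘(ℝ, E) ∞ G] [CompleteSpace E] [T2Space G]

/-- On `U` one has `g = exp (∑ x_i X_i)`, so the compensated integrand is exactly a first-order
Taylor remainder. This gives its integrability near `e`. -/
theorem IsCanonicalCoord.exists_abs_compensated_le (hU : IsCanonicalCoord X U x) {f : G → ℝ}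
    (hf : f ∈ CcSmooth E G) :
    ∃ C, 0 ≤ C ∧ ∀ g ∈ U, |compensated X x f g| ≤ C * ∑ i, x i g ^ 2 := by
  obtain ⟨C, h0, hC⟩ := exists_abs_lieExp_taylor_two_le X hf
  refine ⟨C * d, by positivity, fun g hg => ?_⟩
  have := hC (fun i => x i g)
  rw [hU.exp_eq g hg] at this
  refine this.trans ?_
  rw [mul_assoc]
  exact mul_le_mul_of_nonneg_left (sq_sum_abs_le _) h0

/-- The extra factor `∑ |x_i|` tends to `0` at `e`, which makes the remainder `o(∑ x_i²)`. -/
theorem IsCanonicalCoord.exists_abs_taylor_three_le (hU : IsCanonicalCoord X U x) {f : G → ℝ}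
    (hf : f ∈ CcSmooth E G) :
    ∃ C, 0 ≤ C ∧ ∀ g ∈ U, |f g - f 1 - ∑ i, x i g * lieDeriv (X i) f 1
        - 1 / 2 * ∑ i, ∑ j, x i g * x j g * lieDeriv (X i) (lieDeriv (X j) f) 1|
      ≤ C * (∑ i, |x i g|) * ∑ i, x i g ^ 2 := by
  obtain ⟨C, h0, hC⟩ := exists_abs_lieExp_taylor_three_le X hf
  refine ⟨C * d, by positivity, fun g hg => ?_⟩
  have := hC (fun i => x i g)
  rw [hU.exp_eq g hg] at this
  refine this.trans ?_
  have h1 : 0 ≤ ∑ i, |x i g| := Finset.sum_nonneg fun i _ => abs_nonneg _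
  calc C * (∑ i, |x i g|) ^ 3 = C * (∑ i, |x i g|) * (∑ i, |x i g|) ^ 2 := by ring
    _ ≤ C * (∑ i, |x i g|) * (d * ∑ i, x i g ^ 2) :=
      mul_le_mul_of_nonneg_left (sq_sum_abs_le _) (by positivity)
    _ = _ := by ring

/-- The quadratic bound for `f = x k`, taken at the point with co-ordinates `s • e_i`, is divided by
`s`, and then `s → 0⁺`. -/
theorem IsCanonicalCoord.lieDeriv_eq (hU : IsCanonicalCoord X U x) (i k : Fin d) :
    lieDeriv (X i) (x k) 1 = if i = k then 1 else 0 := by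
  classical
  obtain ⟨C, h0, hC⟩ := hU.exists_abs_compensated_le (hU.smooth k)
  have ht : Tendsto (fun s : ℝ => (s • Pi.single i 1 : Fin d → ℝ)) (𝓝[>] 0) (𝓝 0) := by
    have : Tendsto (fun s : ℝ => (s • Pi.single i 1 : Fin d → ℝ)) (𝓝 0)
        (𝓝 ((0 : ℝ) • Pi.single i 1)) :=
      (continuous_id.smul continuous_const).tendsto 0
    rw [zero_smul] at this
    exact this.mono_left nhdsWithin_le_nhds
  set D := lieDeriv (X i) (x k) 1 with hD
  have key : ∀ᶠ s : ℝ in 𝓝[>] 0, |(if i = k then 1 else 0) - D| ≤ C * s := by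
    filter_upwards [ht.eventually hU.exists_eq, self_mem_nhdsWithin] with s hs hs0
    obtain ⟨g, hg, hx⟩ := hs
    have hs0 : 0 < s := hs0
    have h := hC g hg
    have e : ∀ j, x j g = if j = i then s else 0 := fun j => by
      rw [hx j]
      by_cases hj : j = i <;> simp [hj]
    simp only [compensated, hU.map_one, e, ite_mul, zero_mul, ite_pow,
      Finset.sum_ite_eq', Finset.mem_univ, if_true, sub_zero, ne_eq, OfNat.ofNat_ne_zero,
      not_false_eq_true, zero_pow] at h
    rw [← hD] at h
    have e2 : (if k = i then s else 0) - s * D = s * ((if i = k then 1 else 0) - D) := by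
      by_cases hik : i = k
      · simp [hik]; ring
      · simp [hik, Ne.symm hik]
    rw [e2, abs_mul, abs_of_pos hs0] at h
    have : s * |(if i = k then 1 else 0) - D| ≤ s * (C * s) := h.trans (le_of_eq (by ring))
    exact le_of_mul_le_mul_left this hs0
  have lim : Tendsto (fun s : ℝ => C * s) (𝓝[>] 0) (𝓝 0) := by
    have : Tendsto (fun s : ℝ => C * s) (𝓝 0) (𝓝 (C * 0)) :=
      (continuous_const.mul continuous_id).tendsto 0
    rw [mul_zero] at this
    exact this.mono_left nhdsWithin_le_nhds
  have := ge_of_tendsto lim key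
  have := abs_nonpos_iff.1 this
  linarith

end Coordinates

/-! ### Smooth cut-off functions. -/

section Cutoff

variable {E : Type*} [NormedAddCommGroup E] [NormedSpace ℝ E]
  {G : Type*} [TopologicalSpace G] [ChartedSpace E G]

theorem mul_mem_CcSmooth {f F : G → ℝ} (hf : f ∈ CcSmooth E G)
    (hF : ContMDiff 𝓘(ℝ, E) 𝓘(ℝ, ℝ) ∞ F) : f * F ∈ CcSmooth E G :=
  ⟨hf.1.mul hF, hf.2.mul_right⟩

variable [FiniteDimensional ℝ E] [T2Space G] [SecondCountableTopology G]
  [IsManifold 𝓘(ℝ, E) ∞ G]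

theorem exists_cutoff {K O : Set G} (hK : IsCompact K) (hO : IsOpen O) (hKO : K ⊆ O) :
    ∃ f : CcSmooth E G, (∀ g, 0 ≤ f.1 g) ∧ (∀ g, f.1 g ≤ 1) ∧ (∀ᶠ g in 𝓝ˢ K, f.1 g = 1) ∧
      tsupport f.1 ⊆ O := by
  have : LocallyCompactSpace G := ChartedSpace.locallyCompactSpace E G
  obtain ⟨L, hL, hKL, hLO⟩ := exists_compact_between hK hO hKO
  obtain ⟨f, hf1, hf0, hf⟩ := exists_contMDiffMap_one_nhds_of_subset_interior 𝓘(ℝ, E)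
    (n := ⊤) hK.isClosed hKL
  have hs : tsupport f ⊆ L := closure_minimal
    (fun g hg => by_contra fun hgL => hg (hf0 g hgL)) hL.isClosed
  exact ⟨⟨f, f.contMDiff, hL.of_isClosed_subset (isClosed_tsupport _) hs⟩, fun g => (hf g).1,
    fun g => (hf g).2, hf1, hs.trans hLO⟩

theorem exists_zero_iff_eq (a : G) :
    ∃ ρ : G → ℝ, ContMDiff 𝓘(ℝ, E) 𝓘(ℝ, ℝ) ∞ ρ ∧ (∀ g, 0 ≤ ρ g) ∧ ∀ g, ρ g = 0 ↔ g = a := by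
  have : LocallyCompactSpace G := ChartedSpace.locallyCompactSpace E G
  obtain ⟨ρ, hs, hd, h0⟩ := (isOpen_compl_singleton (x := a)).exists_contMDiff_support_eq
    (n := ⊤) 𝓘(ℝ, E)
  refine ⟨ρ, hd, h0, fun g => ?_⟩
  rw [← Function.notMem_support, hs]
  simp

/-- Compactly supported cut-off functions away from a point. -/
theorem exists_cutoff_seq (a : G) :
    ∃ η : ℕ → CcSmooth E G, (∀ n g, 0 ≤ (η n).1 g) ∧ (∀ n g, (η n).1 g ≤ 1) ∧
      (∀ n, a ∉ tsupport (η n).1) ∧ ∀ g, g ≠ a → ∀ᶠ n in atTop, (η n).1 g = 1 := by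
  have : LocallyCompactSpace G := ChartedSpace.locallyCompactSpace E G
  obtain ⟨ρ, hρ, h0, hz⟩ := exists_zero_iff_eq (E := E) a
  let K := CompactExhaustion.choice G
  -- These compact sets avoid `a`, and each point other than `a` lies in all but finitely many of
  -- them.
  have key := fun n : ℕ => exists_cutoff (E := E)
    (K := K n ∩ {g | 1 / ((n : ℝ) + 1) ≤ ρ g}) (O := {a}ᶜ)
    ((K.isCompact n).inter_right (isClosed_le continuous_const hρ.continuous))
    isOpen_compl_singleton (fun g hg hga => by
      have h1 : 1 / ((n : ℝ) + 1) ≤ ρ g := hg.2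
      rw [(hz g).2 hga] at h1
      exact absurd h1 (not_le.2 (by positivity)))
  choose η hη0 hη1 hη hs using key
  refine ⟨η, hη0, hη1, fun n ha => hs n ha rfl, fun g hg => ?_⟩
  have hpos : 0 < ρ g := lt_of_le_of_ne (h0 g) fun h => hg ((hz g).1 h.symm)
  have hlim : ∀ᶠ n : ℕ in atTop, 1 / ((n : ℝ) + 1) < ρ g :=
    tendsto_one_div_add_atTop_nhds_zero_nat.eventually_lt_const hpos
  filter_upwards [hlim, eventually_ge_atTop (K.find g)] with n hn hn'
  exact (hη n).self_of_nhdsSet _ ⟨K.mem_iff_find_le.2 hn', hn.le⟩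

end Cutoff

/-! ### The measure representing `T` away from `e`. -/

section JumpMeasure

variable {E : Type*} [NormedAddCommGroup E] [NormedSpace ℝ E]
  {G : Type*} [TopologicalSpace G] [ChartedSpace E G] [Group G]

/-- `μ` represents the functional `T` on the functions that vanish near the neutral element. -/
structure IsJumpMeasure [MeasurableSpace G] (T : CcSmooth E G →ₗ[ℝ] ℝ) (μ : Measure G) : Prop where
  singleton_one : μ {1} = 0
  integrable : ∀ φ : CcSmooth E G, 1 ∉ tsupport φ.1 → Integrable φ.1 μ
  integral_eq : ∀ φ : CcSmooth E G, 1 ∉ tsupport φ.1 → ∫ g, φ.1 g ∂μ = T φ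

theorem SatisfiesPMP.nonneg {T : CcSmooth E G →ₗ[ℝ] ℝ} (hT : SatisfiesPMP T) (φ : CcSmooth E G)
    (h0 : ∀ g, 0 ≤ φ.1 g) (h1 : φ.1 1 = 0) : 0 ≤ T φ := by
  have := hT (-φ) (fun g => by simpa [h1] using h0 g) (by simp [h1])
  rw [map_neg] at this
  linarith

theorem IsJumpMeasure.lintegral_eq [MeasurableSpace G] {T : CcSmooth E G →ₗ[ℝ] ℝ} {μ : Measure G}
    (hμ : IsJumpMeasure T μ) (φ : CcSmooth E G) (h1 : 1 ∉ tsupport φ.1) (h0 : ∀ g, 0 ≤ φ.1 g) :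
    ∫⁻ g, ENNReal.ofReal (φ.1 g) ∂μ = ENNReal.ofReal (T φ) := by
  rw [← hμ.integral_eq φ h1, ofReal_integral_eq_lintegral_ofReal (hμ.integrable φ h1)
    (Eventually.of_forall h0)]

theorem IsJumpMeasure.ae_ne_one [MeasurableSpace G] {T : CcSmooth E G →ₗ[ℝ] ℝ} {μ : Measure G}
    (hμ : IsJumpMeasure T μ) : ∀ᵐ g ∂μ, g ≠ 1 := by
  rw [ae_iff]
  simpa using hμ.singleton_one

/-- A positive functional on smooth functions is given by a measure. -/
theorem exists_measure_of_nonneg [FiniteDimensional ℝ E] [T2Space G] [SecondCountableTopology G]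
    [IsManifold 𝓘(ℝ, E) ∞ G] [MeasurableSpace G] [BorelSpace G] (L : CcSmooth E G →ₗ[ℝ] ℝ)
    (hL : ∀ φ : CcSmooth E G, (∀ g, 0 ≤ φ.1 g) → 0 ≤ L φ) :
    ∃ ν : Measure G, IsFiniteMeasureOnCompacts ν ∧ ∀ φ : CcSmooth E G, ∫ g, φ.1 g ∂ν = L φ := by
  have : LocallyCompactSpace G := ChartedSpace.locallyCompactSpace E G
  let p : Submodule ℝ C_c(G, ℝ) :=
    { carrier := {f | ⇑f ∈ CcSmooth E G}
      add_mem' := fun hf hg => (CcSmooth E G).add_mem hf hg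
      zero_mem' := (CcSmooth E G).zero_mem
      smul_mem' := fun c _ hf => (CcSmooth E G).smul_mem c hf }
  let q : p →ₗ[ℝ] CcSmooth E G :=
    { toFun := fun f => ⟨⇑f.1, f.2⟩
      map_add' := fun _ _ => rfl
      map_smul' := fun _ _ => rfl }
  let s : PointedCone ℝ C_c(G, ℝ) :=
    { carrier := {f | ∀ g, 0 ≤ f g}
      add_mem' := fun hf hg k => add_nonneg (hf k) (hg k)
      zero_mem' := fun _ => le_rfl
      smul_mem' := fun c _ hf k => mul_nonneg c.2 (hf k) }
  -- The extension theorem needs every `y` to become nonnegative after adding a smooth function: `C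
  -- • f` works, with `|y| ≤ C` and `f = 1` on the support of `y`.
  obtain ⟨Λ, hΛ, hΛ0⟩ := riesz_extension s ⟨p, L.comp q⟩ (fun f hf => hL _ hf) (fun y => by
    obtain ⟨C, hC⟩ := y.hasCompactSupport.exists_bound_of_continuous y.continuous
    obtain ⟨f, hf0, -, hf1, -⟩ := exists_cutoff (E := E) y.hasCompactSupport isOpen_univ
      (subset_univ _)
    have hC0 : 0 ≤ C := (norm_nonneg _).trans (hC 1)
    refine ⟨⟨⟨⟨(C • f).1, (C • f).2.1.continuous⟩, (C • f).2.2⟩, (C • f).2⟩, fun g => ?_⟩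
    change 0 ≤ C * f.1 g + y g
    by_cases hg : g ∈ tsupport y
    · rw [hf1.self_of_nhdsSet g hg]
      have := (abs_le.1 (hC g)).1
      linarith
    · rw [image_eq_zero_of_notMem_tsupport hg, add_zero]
      exact mul_nonneg hC0 (hf0 g))
  refine ⟨RealRMK.rieszMeasure (PositiveLinearMap.mk₀ Λ fun f hf => hΛ0 f hf), inferInstance,
    fun φ => ?_⟩
  have h1 := RealRMK.integral_rieszMeasure (PositiveLinearMap.mk₀ Λ fun f hf => hΛ0 f hf)
    (⟨⟨φ.1, φ.2.1.continuous⟩, φ.2.2⟩ : C_c(G, ℝ))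
  exact h1.trans (hΛ (⟨⟨⟨φ.1, φ.2.1.continuous⟩, φ.2.2⟩, φ.2⟩ : p))

variable [FiniteDimensional ℝ E] [T2Space G] [SecondCountableTopology G]
  [LieGroup 𝓘(ℝ, E) ∞ G] [MeasurableSpace G] [BorelSpace G]

/-- `T` is known to be positive only on functions vanishing at `e`. The weight `ρ` removes this
restriction and is divided out afterwards. -/
theorem exists_isJumpMeasure {T : CcSmooth E G →ₗ[ℝ] ℝ} (hT : SatisfiesPMP T) :
    ∃ μ : Measure G, IsJumpMeasure T μ := by
  obtain ⟨ρ, hρ, hρ0, hρz⟩ := exists_zero_iff_eq (E := E) (1 : G)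
  let L : CcSmooth E G →ₗ[ℝ] ℝ :=
    { toFun := fun φ => T ⟨φ.1 * ρ, mul_mem_CcSmooth φ.2 hρ⟩
      map_add' := fun φ ψ => by
        rw [← map_add]
        congr 1
        exact Subtype.ext (add_mul φ.1 ψ.1 ρ)
      map_smul' := fun c φ => by
        rw [← map_smul]
        congr 1
        exact Subtype.ext (smul_mul_assoc c φ.1 ρ) }
  obtain ⟨ν, hν, hνL⟩ := exists_measure_of_nonneg L (fun φ hφ => hT.nonneg _
    (fun g => mul_nonneg (hφ g) (hρ0 g)) (by simp [(hρz 1).2 rfl]))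
  have hm : Measurable fun g => ENNReal.ofReal (ρ g)⁻¹ :=
    hρ.continuous.measurable.inv.ennreal_ofReal
  have hmul : ∀ (φ : CcSmooth E G) g, (ENNReal.ofReal (ρ g)⁻¹).toReal • φ.1 g = φ.1 g / ρ g :=
    fun φ g => by
      rw [ENNReal.toReal_ofReal (inv_nonneg.2 (hρ0 g)), smul_eq_mul, div_eq_inv_mul]
  -- Near `e` the quotient is identically `0`, also at `e` itself, where it reads `0 / 0 = 0`.
  have hdiv : ∀ φ : CcSmooth E G, 1 ∉ tsupport φ.1 → (fun g => φ.1 g / ρ g) ∈ CcSmooth E G := by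
    refine fun φ hφ => ⟨fun g => ?_, ?_⟩
    · by_cases hg : g = 1
      · subst hg
        refine (contMDiffAt_const (c := (0 : ℝ))).congr_of_eventuallyEq ?_
        filter_upwards [notMem_tsupport_iff_eventuallyEq.1 hφ] with k hk
        simp [hk]
      · exact (φ.2.1 g).div₀ (hρ g) fun h => hg ((hρz g).1 h)
    · exact φ.2.2.mono fun g hg h => hg (by simp [h])
  -- `ν` may have an atom at `e`, coming from the second-order part of `T`; it is not part of the
  -- jump measure.
  refine ⟨(ν.restrict {1}ᶜ).withDensity fun g => ENNReal.ofReal (ρ g)⁻¹, ?_, fun φ hφ => ?_,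
    fun φ hφ => ?_⟩
  · rw [withDensity_apply _ (measurableSet_singleton 1), Measure.restrict_restrict
      (measurableSet_singleton 1)]
    simp
  · rw [integrable_withDensity_iff_integrable_smul' hm (by simp)]
    simp only [hmul]
    exact ((hdiv φ hφ).1.continuous.integrable_of_hasCompactSupport (hdiv φ hφ).2).restrict
  · rw [integral_withDensity_eq_integral_toReal_smul hm (by simp)]
    simp only [hmul]
    rw [setIntegral_eq_integral_of_forall_compl_eq_zero (fun g hg => by
      have : g = 1 := by simpa using hg
      simp [this, (hρz 1).2 rfl])]
    refine (hνL ⟨_, hdiv φ hφ⟩).trans (congrArg T (Subtype.ext (funext fun g => ?_)))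
    change φ.1 g / ρ g * ρ g = φ.1 g
    by_cases hg : g = 1
    · rw [hg, image_eq_zero_of_notMem_tsupport hφ]
      simp
    · exact div_mul_cancel₀ _ fun h => hg ((hρz g).1 h)

/-- A bound on `T` over all cut-offs of `F ≥ 0` bounds the integral of `F`. -/
theorem IsJumpMeasure.lintegral_le {T : CcSmooth E G →ₗ[ℝ] ℝ} {μ : Measure G}
    (hμ : IsJumpMeasure T μ) {F : G → ℝ} (hF : ContMDiff 𝓘(ℝ, E) 𝓘(ℝ, ℝ) ∞ F)
    (h0 : ∀ g, 0 ≤ F g) {C : ℝ}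
    (hC : ∀ η : CcSmooth E G, (∀ g, 0 ≤ η.1 g) → (∀ g, η.1 g ≤ 1) → 1 ∉ tsupport η.1 →
      T ⟨η.1 * F, mul_mem_CcSmooth η.2 hF⟩ ≤ C) :
    ∫⁻ g, ENNReal.ofReal (F g) ∂μ ≤ ENNReal.ofReal C := by
  -- The cut-offs converge to `1` off the null set `{1}`. They need not be monotone, so the uniform
  -- bound passes to `F` by Fatou's lemma.
  obtain ⟨η, hη0, hη1, hηs, hηe⟩ := exists_cutoff_seq (E := E) (1 : G)
  have hle : ∀ n, ∫⁻ g, ENNReal.ofReal ((η n).1 g * F g) ∂μ ≤ ENNReal.ofReal C := fun n => by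
    have := hμ.lintegral_eq ⟨(η n).1 * F, mul_mem_CcSmooth (η n).2 hF⟩
      (fun h => hηs n (tsupport_mul_subset_left h)) (fun g => mul_nonneg (hη0 n g) (h0 g))
    exact this.le.trans (ENNReal.ofReal_le_ofReal (hC _ (hη0 n) (hη1 n) (hηs n)))
  calc ∫⁻ g, ENNReal.ofReal (F g) ∂μ
      = ∫⁻ g, liminf (fun n => ENNReal.ofReal ((η n).1 g * F g)) atTop ∂μ := by
        refine lintegral_congr_ae ?_
        filter_upwards [hμ.ae_ne_one] with g hg
        refine (Tendsto.liminf_eq (tendsto_const_nhds.congr' ?_)).symm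
        filter_upwards [hηe g hg] with n hn
        rw [hn, one_mul]
    _ ≤ liminf (fun n => ∫⁻ g, ENNReal.ofReal ((η n).1 g * F g) ∂μ) atTop :=
        lintegral_liminf_le fun n =>
          ((η n).2.1.continuous.mul hF.continuous).measurable.ennreal_ofReal
    _ ≤ ENNReal.ofReal C := liminf_le_of_le (by isBoundedDefault)
        fun b hb => by
          obtain ⟨n, hn⟩ := hb.exists
          exact hn.trans (hle n)

/-- The function `(1 - η) * f` is nonnegative and vanishes at `e`, so `T (η * f) ≤ T f` for every
cut-off `η`. -/
theorem IsJumpMeasure.lintegral_le_of_nonneg {T : CcSmooth E G →ₗ[ℝ] ℝ} {μ : Measure G}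
    (hμ : IsJumpMeasure T μ) (hT : SatisfiesPMP T) (f : CcSmooth E G) (h0 : ∀ g, 0 ≤ f.1 g)
    (h1 : f.1 1 = 0) : ∫⁻ g, ENNReal.ofReal (f.1 g) ∂μ ≤ ENNReal.ofReal (T f) := by
  refine hμ.lintegral_le f.2.1 h0 fun η _ hη1 _ => ?_
  have := hT.nonneg (f - ⟨η.1 * f.1, mul_mem_CcSmooth η.2 f.2.1⟩) (fun g => ?_) ?_
  · rw [map_sub] at this
    linarith
  · change 0 ≤ f.1 g - η.1 g * f.1 g
    nlinarith [hη1 g, h0 g]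
  · change f.1 1 - η.1 1 * f.1 1 = 0
    simp [h1]

/-- The function `ψ + η * (1 - ψ)` still has its maximum `1` at `e`, and the PMP applies to it. The
bound gives both finite mass away from `e` and `c ≥ 0`. -/
theorem IsJumpMeasure.lintegral_one_sub_le {T : CcSmooth E G →ₗ[ℝ] ℝ} {μ : Measure G}
    (hμ : IsJumpMeasure T μ) (hT : SatisfiesPMP T) (ψ : CcSmooth E G)
    (hle : ∀ g, ψ.1 g ≤ 1) (h1 : ψ.1 1 = 1) :
    ∫⁻ g, ENNReal.ofReal (1 - ψ.1 g) ∂μ ≤ ENNReal.ofReal (-T ψ) := by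
  have hF : ContMDiff 𝓘(ℝ, E) 𝓘(ℝ, ℝ) ∞ fun g => 1 - ψ.1 g := contMDiff_const.sub ψ.2.1
  refine hμ.lintegral_le hF (fun g => sub_nonneg.2 (hle g)) fun η _ hη1 _ => ?_
  have e : (ψ + ⟨η.1 * fun g => 1 - ψ.1 g, mul_mem_CcSmooth η.2 hF⟩ : CcSmooth E G).1
      = fun g => ψ.1 g + η.1 g * (1 - ψ.1 g) := rfl
  have := hT (ψ + ⟨η.1 * fun g => 1 - ψ.1 g, mul_mem_CcSmooth η.2 hF⟩) (fun g => ?_) ?_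
  · rw [map_add] at this
    linarith
  · rw [e]
    simp only [h1]
    nlinarith [hη1 g, hle g]
  · rw [e]
    simp [h1]

theorem IsJumpMeasure.isLevyMeasure {T : CcSmooth E G →ₗ[ℝ] ℝ} {μ : Measure G}
    (hμ : IsJumpMeasure T μ) (hT : SatisfiesPMP T) {d : ℕ}
    (X : Module.Basis (Fin d) ℝ (GroupLieAlgebra 𝓘(ℝ, E) G)) : IsLevyMeasure X μ where
  singleton_one := hμ.singleton_one
  lintegral_lt_top U x hU := by
    have hm : (fun g => ∑ i, x i g ^ 2) ∈ CcSmooth E G := by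
      have : (∑ i, x i * x i) ∈ CcSmooth E G :=
        (CcSmooth E G).sum_mem fun i _ => mul_mem_CcSmooth (hU.smooth i) (hU.smooth i).1
      convert! this using 1
      funext g
      simp [pow_two]
    have h0 : ∀ g, 0 ≤ ∑ i, x i g ^ 2 := fun g => Finset.sum_nonneg fun i _ => sq_nonneg _
    refine (setLIntegral_le_lintegral _ _).trans_lt
      ((hμ.lintegral_le_of_nonneg hT ⟨_, hm⟩ h0 ?_).trans_lt ENNReal.ofReal_lt_top)
    simp [hU.map_one]
  compl_lt_top U x hU := by
    -- A bump supported in `U` makes `1 - ψ` equal to `1` on `Uᶜ`.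
    obtain ⟨ψ, -, hle, h1, hs⟩ := exists_cutoff (E := E) (isCompact_singleton (x := (1 : G)))
      hU.isOpen (singleton_subset_iff.2 hU.one_mem)
    have h := hμ.lintegral_one_sub_le hT ψ hle (h1.self_of_nhdsSet 1 rfl)
    refine lt_of_le_of_lt ?_ (h.trans_lt ENNReal.ofReal_lt_top)
    rw [← setLIntegral_one]
    refine (setLIntegral_mono_ae' hU.isOpen.measurableSet.compl
      (Eventually.of_forall fun g hg => ?_)).trans (setLIntegral_le_lintegral _ _)
    rw [image_eq_zero_of_notMem_tsupport fun h => hg (hs h)]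
    simp

/-- `O` is approximated from inside by compact `K`, and a cut-off between `K` and `O` has the same
integral for both measures. -/
theorem IsJumpMeasure.measure_le_of_isOpen {T : CcSmooth E G →ₗ[ℝ] ℝ} {μ μ' : Measure G}
    (hμ : IsJumpMeasure T μ) (hμ' : IsJumpMeasure T μ') {O : Set G} (hO : IsOpen O)
    (h1 : (1 : G) ∉ O) : μ O ≤ μ' O := by
  have : LocallyCompactSpace G := ChartedSpace.locallyCompactSpace E G
  refine le_of_forall_lt fun r hr => ?_
  obtain ⟨F, hFO, hF, hrF⟩ := Measure.InnerRegularWRT.of_pseudoMetrizableSpace μ hO r hr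
  obtain ⟨K, hKF, hK, hrK⟩ := Measure.InnerRegularWRT.isCompact_isClosed μ hF r hrF
  refine hrK.trans_le ?_
  obtain ⟨f, hf0, hf1, hfK, hs⟩ := exists_cutoff (E := E) hK hO (hKF.trans hFO)
  have h1s : (1 : G) ∉ tsupport f.1 := fun h => h1 (hs h)
  calc μ K = ∫⁻ g in K, 1 ∂μ := by rw [setLIntegral_one]
    _ ≤ ∫⁻ g in K, ENNReal.ofReal (f.1 g) ∂μ :=
      setLIntegral_mono_ae' hK.isClosed.measurableSet (Eventually.of_forall fun g hg => by
        rw [hfK.self_of_nhdsSet g hg]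
        simp)
    _ ≤ ∫⁻ g, ENNReal.ofReal (f.1 g) ∂μ := setLIntegral_le_lintegral _ _
    _ = ∫⁻ g, ENNReal.ofReal (f.1 g) ∂μ' := by
      rw [hμ.lintegral_eq f h1s hf0, hμ'.lintegral_eq f h1s hf0]
    _ ≤ ∫⁻ g, O.indicator 1 g ∂μ' := lintegral_mono fun g => by
      by_cases hg : g ∈ O
      · simpa [hg] using hf1 g
      · simp [hg, image_eq_zero_of_notMem_tsupport fun h => hg (hs h)]
    _ = μ' O := lintegral_indicator_one hO.measurableSet

/-- Both measures may be infinite near `e`. They are compared on the open sets `W n`, which have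
finite measure, avoid `e` and cover everything else. -/
theorem IsJumpMeasure.unique {T : CcSmooth E G →ₗ[ℝ] ℝ} {μ μ' : Measure G}
    (hμ : IsJumpMeasure T μ) (hμ' : IsJumpMeasure T μ') : μ = μ' := by
  obtain ⟨η, hη0, hη1, hηs, hηe⟩ := exists_cutoff_seq (E := E) (1 : G)
  let W : ℕ → Set G := fun n => {g | 1 / 2 < (η n).1 g}
  have hW : ∀ n, IsOpen (W n) := fun n => isOpen_lt continuous_const (η n).2.1.continuous
  have h1W : ∀ n, (1 : G) ∉ W n := fun n h => by
    have h : 1 / 2 < (η n).1 1 := h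
    rw [image_eq_zero_of_notMem_tsupport (hηs n)] at h
    norm_num at h
  have heq : ∀ O : Set G, IsOpen O → (1 : G) ∉ O → μ O = μ' O := fun O hO h1 =>
    le_antisymm (hμ.measure_le_of_isOpen hμ' hO h1) (hμ'.measure_le_of_isOpen hμ hO h1)
  have hfin : ∀ n, μ (W n) < ⊤ := fun n =>
    (hμ.integrable (η n) (hηs n)).measure_gt_lt_top (by norm_num)
  have hres : μ.restrict (⋃ n, W n) = μ'.restrict (⋃ n, W n) := by
    refine Measure.restrict_iUnion_congr.2 fun n => ?_
    have : IsFiniteMeasure (μ.restrict (W n)) := ⟨by simpa using hfin n⟩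
    refine ext_of_generate_finite {s | IsOpen s} (BorelSpace.measurable_eq) isPiSystem_isOpen
      (fun s hs => ?_) ?_
    · have hs : IsOpen s := hs
      rw [Measure.restrict_apply hs.measurableSet, Measure.restrict_apply hs.measurableSet]
      exact heq _ (hs.inter (hW n)) fun h => h1W n h.2
    · simpa using heq _ (hW n) (h1W n)
  have hU : ∀ g : G, g ≠ 1 → g ∈ ⋃ n, W n := fun g hg => by
    obtain ⟨n, hn⟩ := (hηe g hg).exists
    refine mem_iUnion.2 ⟨n, ?_⟩
    change 1 / 2 < (η n).1 g
    rw [hn]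
    norm_num
  rwa [Measure.restrict_eq_self_of_ae_mem (hμ.ae_ne_one.mono hU),
    Measure.restrict_eq_self_of_ae_mem (hμ'.ae_ne_one.mono hU)] at hres

end JumpMeasure

/-! ### The local part, the canonical form and uniqueness. -/

section CanonicalForm

variable {E : Type*} [NormedAddCommGroup E] [NormedSpace ℝ E]
  {G : Type*} [TopologicalSpace G] [ChartedSpace E G] [Group G]
  {d : ℕ} {X : Module.Basis (Fin d) ℝ (GroupLieAlgebra 𝓘(ℝ, E) G)}
  {U : Set G} {x : Fin d → G → ℝ}

theorem compensated_add {f f' : G → ℝ} (hf : f ∈ CcSmooth E G) (hf' : f' ∈ CcSmooth E G) :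
    compensated X x (f + f') = compensated X x f + compensated X x f' := by
  funext g
  simp only [compensated, lieDeriv_add _ hf.1 hf'.1, Pi.add_apply, mul_add,
    Finset.sum_add_distrib]
  ring

theorem compensated_smul (c : ℝ) {f : G → ℝ} (hf : f ∈ CcSmooth E G) :
    compensated X x (c • f) = c • compensated X x f := by
  funext g
  simp only [compensated, lieDeriv_smul _ _ hf.1, Pi.smul_apply, smul_eq_mul,
    mul_left_comm _ c, ← Finset.mul_sum]
  ring

theorem compensated_eq_sub {f : G → ℝ} (h : ∀ i, lieDeriv (X i) f 1 = 0) :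
    compensated X x f = fun g => f g - f 1 := by
  funext g
  simp [compensated, h]

theorem lieDeriv_eq_zero_of_eventuallyEq_const (v : GroupLieAlgebra 𝓘(ℝ, E) G) {f : G → ℝ} {c : ℝ}
    {g : G} (h : f =ᶠ[𝓝 g] fun _ => c) : lieDeriv v f g = 0 := by
  rw [lieDeriv_congr v h, lieDeriv_const]

theorem lieDeriv_lieDeriv_eq_zero_of_eventuallyEq_const (v w : GroupLieAlgebra 𝓘(ℝ, E) G)
    {f : G → ℝ} {c : ℝ} {g : G} (h : f =ᶠ[𝓝 g] fun _ => c) :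
    lieDeriv v (lieDeriv w f) g = 0 :=
  lieDeriv_eq_zero_of_eventuallyEq_const v (c := 0)
    ((lieDeriv_congr_nhds w h).trans (Eventually.of_forall fun k => lieDeriv_const w c k))

theorem compensated_eq_self_of_notMem_tsupport {f : G → ℝ} (h : 1 ∉ tsupport f) :
    compensated X x f = f := by
  have h0 : f =ᶠ[𝓝 1] fun _ => 0 := notMem_tsupport_iff_eventuallyEq.1 h
  rw [compensated_eq_sub fun i => lieDeriv_eq_zero_of_eventuallyEq_const _ h0]
  simp [image_eq_zero_of_notMem_tsupport h]

/-- The quadratic form at `ξ` is half of `S` at `(∑ ξ_i x_i)²`, a nonnegative function vanishing at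
`e`. -/
theorem IsCanonicalCoord.posSemidef (hU : IsCanonicalCoord X U x) {S : CcSmooth E G →ₗ[ℝ] ℝ}
    (hpos : ∀ φ : CcSmooth E G, (∀ g, 0 ≤ φ.1 g) → φ.1 1 = 0 → 0 ≤ S φ) :
    (Matrix.of fun i j =>
      1 / 2 * S ⟨x i * x j, mul_mem_CcSmooth (hU.smooth i) (hU.smooth j).1⟩).PosSemidef := by
  refine Matrix.PosSemidef.of_dotProduct_mulVec_nonneg ?_ fun ξ => ?_
  · ext i j
    simp only [Matrix.conjTranspose_apply, Matrix.of_apply, star_trivial, mul_comm (x j)]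
  · have h := hpos (∑ i, ∑ j, (ξ i * ξ j) •
      (⟨x i * x j, mul_mem_CcSmooth (hU.smooth i) (hU.smooth j).1⟩ : CcSmooth E G))
      (fun g => ?_) ?_
    · simp only [map_sum, map_smul, smul_eq_mul] at h
      have e : star ξ ⬝ᵥ (Matrix.of fun i j => 1 / 2 *
          S ⟨x i * x j, mul_mem_CcSmooth (hU.smooth i) (hU.smooth j).1⟩).mulVec ξ
          = 1 / 2 * ∑ i, ∑ j, ξ i * ξ j *
            S ⟨x i * x j, mul_mem_CcSmooth (hU.smooth i) (hU.smooth j).1⟩ := by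
        simp only [dotProduct, Matrix.mulVec, Matrix.of_apply, star_trivial, Finset.mul_sum]
        exact Finset.sum_congr rfl fun i _ => Finset.sum_congr rfl fun j _ => by ring
      rw [e]
      positivity
    · have e : (∑ i, ξ i * x i g) ^ 2 = ∑ i, ∑ j, ξ i * ξ j * (x i g * x j g) := by
        rw [pow_two, Finset.sum_mul_sum]
        exact Finset.sum_congr rfl fun i _ => Finset.sum_congr rfl fun j _ => by ring
      simp only [Submodule.coe_sum, Submodule.coe_smul, Finset.sum_apply, Pi.smul_apply,
        Pi.mul_apply, smul_eq_mul]
      rw [← e]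
      exact sq_nonneg _
    · simp [Finset.sum_apply, hU.map_one]

variable [FiniteDimensional ℝ E] [T2Space G] [LieGroup 𝓘(ℝ, E) ∞ G]

theorem compensated_eq_self_of_nonneg {f : G → ℝ} (hf : f ∈ CcSmooth E G) (h0 : ∀ g, 0 ≤ f g)
    (h1 : f 1 = 0) : compensated X x f = f := by
  have : CompleteSpace E := FiniteDimensional.complete ℝ E
  rw [compensated_eq_sub fun i => lieDeriv_one_eq_zero_of_isLocalExtr _ hf.1
    (Or.inl (Eventually.of_forall fun g => h1.trans_le (h0 g)))]
  simp [h1]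

/-- Second derivatives of a single co-ordinate come multiplied by a co-ordinate, which vanishes at
`e`; only products of first derivatives remain. -/
theorem IsCanonicalCoord.lieDeriv_lieDeriv_mul_eq (hU : IsCanonicalCoord X U x) (i j k l : Fin d) :
    lieDeriv (X i) (lieDeriv (X j) (x k * x l)) 1
      = (if i = k then 1 else 0) * (if j = l then 1 else 0)
        + (if i = l then 1 else 0) * (if j = k then 1 else 0) := by
  have : CompleteSpace E := FiniteDimensional.complete ℝ E
  have e : lieDeriv (X j) (x k * x l) = x k * lieDeriv (X j) (x l) + x l * lieDeriv (X j) (x k) :=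
    funext fun g => lieDeriv_mul _ (hU.smooth k).1 (hU.smooth l).1 g
  have hs : ∀ m, ContMDiff 𝓘(ℝ, E) 𝓘(ℝ, ℝ) ∞ (lieDeriv (X j) (x m)) := fun m =>
    contMDiff_lieDeriv _ (hU.smooth m).1
  rw [e, lieDeriv_add _ ((hU.smooth k).1.mul (hs l)) ((hU.smooth l).1.mul (hs k)),
    lieDeriv_mul _ (hU.smooth k).1 (hs l), lieDeriv_mul _ (hU.smooth l).1 (hs k)]
  simp only [hU.map_one, hU.lieDeriv_eq]
  ring

/-- On `U` the integrand is dominated by a multiple of `∑ x_i²`; on `Uᶜ` it is bounded and the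
measure is finite. -/
theorem IsLevyMeasure.integrable_compensated [MeasurableSpace G] [BorelSpace G] {μ : Measure G}
    (hμ : IsLevyMeasure X μ)
    (hU : IsCanonicalCoord X U x) {f : G → ℝ} (hf : f ∈ CcSmooth E G) :
    Integrable (compensated X x f) μ := by
  have : CompleteSpace E := FiniteDimensional.complete ℝ E
  have hx := fun i => (hU.smooth i).1.continuous
  have hfc := hf.1.continuous
  have hc : Continuous (compensated X x f) := by
    unfold compensated
    fun_prop
  have hU1 : IntegrableOn (compensated X x f) U μ := by
    obtain ⟨C, hC0, hC⟩ := hU.exists_abs_compensated_le hf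
    have hq : IntegrableOn (fun g => ∑ i, x i g ^ 2) U μ := by
      refine ⟨Continuous.aestronglyMeasurable (by fun_prop), ?_⟩
      rw [hasFiniteIntegral_iff_ofReal (Eventually.of_forall fun g =>
        Finset.sum_nonneg fun i _ => sq_nonneg _)]
      exact hμ.lintegral_lt_top U x hU
    refine Integrable.mono' (hq.const_mul C) hc.aestronglyMeasurable ?_
    exact (ae_restrict_iff' hU.isOpen.measurableSet).2 (Eventually.of_forall hC)
  have hU2 : IntegrableOn (compensated X x f) Uᶜ μ := by
    obtain ⟨A, -, hA⟩ := exists_abs_le_of_mem hf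
    obtain ⟨B, hB0, hB⟩ := exists_forall_abs_le_of_mem hU.smooth
    refine Measure.integrableOn_of_bounded (M := A + A + ∑ i, B * |lieDeriv (X i) f 1|)
      (hμ.compl_lt_top U x hU).ne hc.aestronglyMeasurable (Eventually.of_forall fun g => ?_)
    refine (abs_sub _ _).trans (add_le_add ((abs_sub _ _).trans (add_le_add (hA g) (hA 1)))
      ((Finset.abs_sum_le_sum_abs _ _).trans (Finset.sum_le_sum fun i _ => ?_)))
    rw [abs_mul]
    exact mul_le_mul_of_nonneg_right (hB i g) (abs_nonneg _)
  rw [← integrableOn_univ, ← union_compl_self U]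
  exact hU1.union hU2

/-- All local terms vanish on functions that are zero near `e`. Uniqueness of `μ` thus reduces to
`IsJumpMeasure.unique`. -/
theorem HasCharacteristics.isJumpMeasure [MeasurableSpace G] [BorelSpace G] {μ : Measure G}
    {T : CcSmooth E G →ₗ[ℝ] ℝ}
    {a : Matrix (Fin d) (Fin d) ℝ} {b : Fin d → ℝ} {c : ℝ}
    (h : HasCharacteristics X x T a b c μ) (hU : IsCanonicalCoord X U x) : IsJumpMeasure T μ where
  singleton_one := h.levy.singleton_one
  integrable φ hφ := by
    have := h.levy.integrable_compensated hU φ.2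
    rwa [compensated_eq_self_of_notMem_tsupport hφ] at this
  integral_eq φ hφ := by
    have h0 : φ.1 =ᶠ[𝓝 1] fun _ => 0 := notMem_tsupport_iff_eventuallyEq.1 hφ
    rw [h.form φ, compensated_eq_self_of_notMem_tsupport hφ]
    simp [lieDeriv_eq_zero_of_eventuallyEq_const _ h0,
      lieDeriv_lieDeriv_eq_zero_of_eventuallyEq_const _ _ h0, h0.self_of_nhds]

variable [SecondCountableTopology G]

/-- A functional that vanishes on functions vanishing near `e`, and is nonnegative on nonnegative
functions vanishing at `e`, is nonnegative on functions that have a local minimum zero at `e`. -/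
theorem nonneg_of_eventually_nonneg {S : CcSmooth E G →ₗ[ℝ] ℝ}
    (hloc : ∀ φ : CcSmooth E G, 1 ∉ tsupport φ.1 → S φ = 0)
    (hpos : ∀ φ : CcSmooth E G, (∀ g, 0 ≤ φ.1 g) → φ.1 1 = 0 → 0 ≤ S φ)
    (φ : CcSmooth E G) (h0 : ∀ᶠ g in 𝓝 1, 0 ≤ φ.1 g) (h1 : φ.1 1 = 0) : 0 ≤ S φ := by
  obtain ⟨O, hO, hOo, h1O⟩ := eventually_nhds_iff.1 h0
  obtain ⟨χ, hχ0, -, hχ1, hs⟩ := exists_cutoff (E := E) (isCompact_singleton (x := (1 : G)))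
    hOo (singleton_subset_iff.2 h1O)
  rw [nhdsSet_singleton] at hχ1
  -- `χ` is supported where `φ ≥ 0`, so `θ` is nonnegative everywhere and differs from `φ` only away
  -- from `e`.
  let θ : CcSmooth E G := ⟨χ.1 * φ.1, mul_mem_CcSmooth χ.2 φ.2.1⟩
  have hθ : 0 ≤ S θ := hpos θ (fun g => by
    change 0 ≤ χ.1 g * φ.1 g
    by_cases hg : g ∈ O
    · exact mul_nonneg (hχ0 g) (hO g hg)
    · rw [image_eq_zero_of_notMem_tsupport fun h => hg (hs h), zero_mul]) (by
    change χ.1 1 * φ.1 1 = 0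
    rw [h1, mul_zero])
  have hd : S (φ - θ) = 0 := hloc _ (notMem_tsupport_iff_eventuallyEq.2 (by
    filter_upwards [hχ1] with g hg
    change φ.1 g - χ.1 g * φ.1 g = 0
    rw [hg, one_mul, sub_self]))
  rw [map_sub] at hd
  linarith

/-- The canonical form of the local part. -/
theorem IsCanonicalCoord.local_eq (hU : IsCanonicalCoord X U x) {S : CcSmooth E G →ₗ[ℝ] ℝ}
    (hloc : ∀ φ : CcSmooth E G, 1 ∉ tsupport φ.1 → S φ = 0)
    (hpos : ∀ φ : CcSmooth E G, (∀ g, 0 ≤ φ.1 g) → φ.1 1 = 0 → 0 ≤ S φ)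
    {ψ : CcSmooth E G} (hψ : ∀ᶠ g in 𝓝 1, ψ.1 g = 1) (φ : CcSmooth E G) :
    S φ = ∑ i, ∑ j, 1 / 2 * S ⟨x i * x j, mul_mem_CcSmooth (hU.smooth i) (hU.smooth j).1⟩
        * lieDeriv (X i) (lieDeriv (X j) φ.1) 1
      + ∑ i, S ⟨x i, hU.smooth i⟩ * lieDeriv (X i) φ.1 1 + S ψ * φ.1 1 := by
  have : CompleteSpace E := FiniteDimensional.complete ℝ E
  obtain ⟨C, hC0, hC⟩ := hU.exists_abs_taylor_three_le φ.2
  let y : Fin d → CcSmooth E G := fun i => ⟨x i, hU.smooth i⟩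
  let z : Fin d → Fin d → CcSmooth E G := fun i j =>
    ⟨x i * x j, mul_mem_CcSmooth (hU.smooth i) (hU.smooth j).1⟩
  -- The second-order Taylor remainder of `φ`, with `ψ` in place of the constant `1`, which need not
  -- have compact support. It remains to show `S R = 0`.
  let R : CcSmooth E G := φ - φ.1 1 • ψ - ∑ i, lieDeriv (X i) φ.1 1 • y i
    - ∑ i, ∑ j, (1 / 2 * lieDeriv (X i) (lieDeriv (X j) φ.1) 1) • z i j
  let q : CcSmooth E G := ∑ i, z i i
  have hq : ∀ g, q.1 g = ∑ i, x i g ^ 2 := fun g => by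
    simp [q, z, pow_two, Finset.sum_apply]
  have hR : ∀ᶠ g in 𝓝 1, |R.1 g| ≤ C * (∑ i, |x i g|) * ∑ i, x i g ^ 2 := by
    filter_upwards [hψ, hU.isOpen.mem_nhds hU.one_mem] with g hg hgU
    refine le_trans (le_of_eq ?_) (hC g hgU)
    congr 1
    simp only [R, y, z, Submodule.coe_sub, Submodule.coe_smul, Submodule.coe_sum, Pi.sub_apply,
      Pi.smul_apply, Finset.sum_apply, Pi.mul_apply, smul_eq_mul, hg, mul_one]
    simp only [Finset.mul_sum]
    congr 1
    · congr 1
      exact Finset.sum_congr rfl fun i _ => mul_comm _ _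
    · exact Finset.sum_congr rfl fun i _ => Finset.sum_congr rfl fun j _ => by ring
  have hR1 : R.1 1 = 0 := by
    have := hR.self_of_nhds
    simp only [hU.map_one, abs_zero, Finset.sum_const_zero, mul_zero, zero_mul] at this
    exact abs_nonpos_iff.1 this
  have hq1 : q.1 1 = 0 := by simp [hq, hU.map_one]
  have hsmall : ∀ ε > 0, ∀ᶠ g in 𝓝 1, |R.1 g| ≤ ε * q.1 g := fun ε hε => by
    have hcont : Continuous fun g => C * ∑ i, |x i g| := by
      have := fun i => (hU.smooth i).1.continuous
      fun_prop
    have h1 : C * ∑ i, |x i 1| < ε := by simpa [hU.map_one] using hε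
    filter_upwards [hR, hcont.continuousAt.eventually_lt continuousAt_const h1] with g hg hg'
    rw [hq]
    exact hg.trans (mul_le_mul_of_nonneg_right hg'.le
      (Finset.sum_nonneg fun i _ => sq_nonneg _))
  -- Both `ε • q - R` and `ε • q + R` have a local minimum `0` at `e`.
  have hSR : ∀ ε > 0, |S R| ≤ ε * S q := fun ε hε => by
    have h1 := nonneg_of_eventually_nonneg hloc hpos (ε • q - R)
      ((hsmall ε hε).mono fun g hg => sub_nonneg.2 (abs_le.1 hg).2) (by simp [hq1, hR1])
    have h2 := nonneg_of_eventually_nonneg hloc hpos (ε • q + R)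
      ((hsmall ε hε).mono fun g hg => by
        have := (abs_le.1 hg).1
        change 0 ≤ ε * q.1 g + R.1 g
        linarith) (by simp [hq1, hR1])
    rw [map_sub, map_smul, smul_eq_mul] at h1
    rw [map_add, map_smul, smul_eq_mul] at h2
    exact abs_le.2 ⟨by linarith, by linarith⟩
  have hSR0 : S R = 0 := by
    have lim : Tendsto (fun ε : ℝ => ε * S q) (𝓝[>] 0) (𝓝 0) := by
      have : Tendsto (fun ε : ℝ => ε * S q) (𝓝 0) (𝓝 (0 * S q)) :=
        (continuous_id.mul continuous_const).tendsto 0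
      rw [zero_mul] at this
      exact this.mono_left nhdsWithin_le_nhds
    exact abs_nonpos_iff.1 (ge_of_tendsto lim (by
      filter_upwards [self_mem_nhdsWithin] with ε hε
      exact hSR ε hε))
  simp only [R, map_sub, map_sum, map_smul, smul_eq_mul] at hSR0
  have e1 : ∑ i, lieDeriv (X i) φ.1 1 * S (y i) = ∑ i, S (y i) * lieDeriv (X i) φ.1 1 :=
    Finset.sum_congr rfl fun i _ => mul_comm _ _
  have e2 : ∑ i, ∑ j, 1 / 2 * lieDeriv (X i) (lieDeriv (X j) φ.1) 1 * S (z i j)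
      = ∑ i, ∑ j, 1 / 2 * S (z i j) * lieDeriv (X i) (lieDeriv (X j) φ.1) 1 :=
    Finset.sum_congr rfl fun i _ => Finset.sum_congr rfl fun j _ => by ring
  rw [e1, e2] at hSR0
  linarith [hSR0]

variable [MeasurableSpace G] [BorelSpace G] {μ : Measure G}

/-- Subtracting the compensated integral keeps positivity: for `φ ≥ 0` with `φ 1 = 0` the
compensator vanishes, and `∫ φ ∂μ ≤ T φ`. -/
theorem IsJumpMeasure.exists_hasCharacteristics {T : CcSmooth E G →ₗ[ℝ] ℝ}
    (hμ : IsJumpMeasure T μ) (hT : SatisfiesPMP T) (hU : IsCanonicalCoord X U x) :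
    ∃ a b c, HasCharacteristics X x T a b c μ := by
  have hL : IsLevyMeasure X μ := hμ.isLevyMeasure hT X
  have hint : ∀ φ : CcSmooth E G, Integrable (compensated X x φ.1) μ := fun φ =>
    hL.integrable_compensated hU φ.2
  let S : CcSmooth E G →ₗ[ℝ] ℝ := T -
    { toFun := fun φ => ∫ g, compensated X x φ.1 g ∂μ
      map_add' := fun φ ψ => by
        rw [← integral_add (hint φ) (hint ψ)]
        exact congrArg (fun F : G → ℝ => ∫ g, F g ∂μ) (compensated_add φ.2 ψ.2)
      map_smul' := fun r φ => by
        rw [RingHom.id_apply, ← integral_smul]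
        exact congrArg (fun F : G → ℝ => ∫ g, F g ∂μ) (compensated_smul r φ.2) }
  have hS : ∀ φ, S φ = T φ - ∫ g, compensated X x φ.1 g ∂μ := fun φ => rfl
  have hloc : ∀ φ : CcSmooth E G, 1 ∉ tsupport φ.1 → S φ = 0 := fun φ hφ => by
    rw [hS, compensated_eq_self_of_notMem_tsupport hφ, hμ.integral_eq φ hφ, sub_self]
  have hpos : ∀ φ : CcSmooth E G, (∀ g, 0 ≤ φ.1 g) → φ.1 1 = 0 → 0 ≤ S φ := fun φ h0 h1 => by
    rw [hS, compensated_eq_self_of_nonneg φ.2 h0 h1, sub_nonneg,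
      integral_eq_lintegral_of_nonneg_ae (Eventually.of_forall h0)
        φ.2.1.continuous.aestronglyMeasurable]
    exact ENNReal.toReal_le_of_le_ofReal (hT.nonneg φ h0 h1) (hμ.lintegral_le_of_nonneg hT φ h0 h1)
  obtain ⟨ψ, hψ0, hψ1, hψ, -⟩ := exists_cutoff (E := E) (isCompact_singleton (x := (1 : G)))
    isOpen_univ (subset_univ _)
  rw [nhdsSet_singleton] at hψ
  have hψone : ψ.1 1 = 1 := hψ.self_of_nhds
  -- This is `c ≥ 0`: since `ψ = 1` near `e`, `S ψ = T ψ + ∫ (1 - ψ) ∂μ`, and the integral is at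
  -- most `-T ψ`.
  have hSψ : S ψ ≤ 0 := by
    have hTψ : T ψ ≤ 0 := hT ψ (fun g => (hψ1 g).trans_eq hψone.symm) (hψ0 1)
    have h1 : ∫ g, (1 - ψ.1 g) ∂μ ≤ -T ψ := by
      rw [integral_eq_lintegral_of_nonneg_ae (Eventually.of_forall fun g => sub_nonneg.2 (hψ1 g))
        (continuous_const.sub ψ.2.1.continuous).aestronglyMeasurable]
      exact ENNReal.toReal_le_of_le_ofReal (by linarith) (hμ.lintegral_one_sub_le hT ψ hψ1 hψone)
    have h2 : ∫ g, compensated X x ψ.1 g ∂μ = -∫ g, (1 - ψ.1 g) ∂μ := by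
      rw [compensated_eq_sub fun i => lieDeriv_eq_zero_of_eventuallyEq_const _ hψ,
        ← integral_neg]
      simp [hψone]
    rw [hS, h2]
    linarith
  refine ⟨_, fun i => S ⟨x i, hU.smooth i⟩, -S ψ, neg_nonneg.2 hSψ, hU.posSemidef hpos, hL,
    fun φ => ?_⟩
  have h1 := hU.local_eq hloc hpos hψ φ
  have h2 := hS φ
  simp only [Matrix.of_apply]
  linarith

theorem HasCharacteristics.unique {T : CcSmooth E G →ₗ[ℝ] ℝ} (hU : IsCanonicalCoord X U x)
    {a a' : Matrix (Fin d) (Fin d) ℝ} {b b' : Fin d → ℝ} {c c' : ℝ} {μ' : Measure G}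
    (h : HasCharacteristics X x T a b c μ) (h' : HasCharacteristics X x T a' b' c' μ') :
    a' = a ∧ b' = b ∧ c' = c ∧ μ' = μ := by
  have : CompleteSpace E := FiniteDimensional.complete ℝ E
  have hμ : μ' = μ := (h'.isJumpMeasure hU).unique (h.isJumpMeasure hU)
  subst hμ
  have key : ∀ φ : CcSmooth E G,
      ∑ i, ∑ j, a' i j * lieDeriv (X i) (lieDeriv (X j) φ.1) 1
        + ∑ i, b' i * lieDeriv (X i) φ.1 1 - c' * φ.1 1
      = ∑ i, ∑ j, a i j * lieDeriv (X i) (lieDeriv (X j) φ.1) 1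
        + ∑ i, b i * lieDeriv (X i) φ.1 1 - c * φ.1 1 := fun φ => by
    have := (h'.form φ).symm.trans (h.form φ)
    linarith
  have hc : c' = c := by
    obtain ⟨ψ, -, -, hψ, -⟩ := exists_cutoff (E := E) (isCompact_singleton (x := (1 : G)))
      isOpen_univ (subset_univ _)
    rw [nhdsSet_singleton] at hψ
    simpa [lieDeriv_eq_zero_of_eventuallyEq_const _ hψ,
      lieDeriv_lieDeriv_eq_zero_of_eventuallyEq_const _ _ hψ, hψ.self_of_nhds] using key ψ
  have ha : a' = a := by
    ext k l
    have h1 := key ⟨x k * x l, mul_mem_CcSmooth (hU.smooth k) (hU.smooth l).1⟩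
    have hz : ∀ i, lieDeriv (X i) (x k * x l) 1 = 0 := fun i => by
      rw [lieDeriv_mul _ (hU.smooth k).1 (hU.smooth l).1]
      simp [hU.map_one]
    -- The sum yields `m k l + m l k`; without symmetry only the symmetric part of the matrix would
    -- be determined.
    have hsum : ∀ m : Matrix (Fin d) (Fin d) ℝ, m.PosSemidef →
        ∑ i, ∑ j, m i j * lieDeriv (X i) (lieDeriv (X j) (x k * x l)) 1 = 2 * m k l := by
      intro m hm
      have hsymm : m l k = m k l := by simpa using (hm.isHermitian.apply k l)
      simp [hU.lieDeriv_lieDeriv_mul_eq, mul_add, Finset.sum_add_distrib, hsymm, two_mul]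
    simp only [hz, hsum a h.posSemidef, hsum a' h'.posSemidef] at h1
    simpa [hU.map_one] using h1
  subst ha
  refine ⟨rfl, funext fun k => ?_, hc, rfl⟩
  -- With equal matrices the second-order terms cancel, so the second derivatives of `x k` at `e`
  -- need not be known.
  have h1 := key ⟨x k, hU.smooth k⟩
  simpa [hU.lieDeriv_eq, hU.map_one] using h1

end CanonicalForm

end LieGroupPMP

theorem mainTheorem2
    {E : Type*} [NormedAddCommGroup E] [NormedSpace ℝ E] [FiniteDimensional ℝ E]
    {G : Type*} [TopologicalSpace G] [T2Space G] [SecondCountableTopology G]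
    [ChartedSpace E G] [Group G] [LieGroup 𝓘(ℝ, E) ∞ G]
    [MeasurableSpace G] [BorelSpace G]
    {d : ℕ} (X : Module.Basis (Fin d) ℝ (GroupLieAlgebra 𝓘(ℝ, E) G))
    (U : Set G) (x : Fin d → G → ℝ) (hU : LieGroupPMP.IsCanonicalCoord X U x)
    (T : LieGroupPMP.CcSmooth E G →ₗ[ℝ] ℝ) (hT : LieGroupPMP.SatisfiesPMP T) :
    ∃ (a : Matrix (Fin d) (Fin d) ℝ) (b : Fin d → ℝ) (c : ℝ) (μ : Measure G),
      LieGroupPMP.HasCharacteristics X x T a b c μ ∧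
      (∀ φ : LieGroupPMP.CcSmooth E G, Integrable (LieGroupPMP.compensated X x φ.1) μ) ∧
      ∀ (a' : Matrix (Fin d) (Fin d) ℝ) (b' : Fin d → ℝ) (c' : ℝ) (μ' : Measure G),
        LieGroupPMP.HasCharacteristics X x T a' b' c' μ' →
          a' = a ∧ b' = b ∧ c' = c ∧ μ' = μ := by
  obtain ⟨μ, hμ⟩ := LieGroupPMP.exists_isJumpMeasure hT
  obtain ⟨a, b, c, h⟩ := hμ.exists_hasCharacteristics hT hU
  exact ⟨a, b, c, μ, h, fun φ => h.levy.integrable_compensated hU φ.2,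
    fun _ _ _ _ h' => h.unique hU h'⟩
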